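/- **Setting.** Let $(X_t)_{t\in\mathbb Z}$ be a strictly stationary $\mathbb R^d$-valued time series on a probability space, let $F_t$ be the distribution function of $X_t$ (so $F_t=F$ for all $t$), and let $\theta=\theta(F)\in\mathbb R^p$ be a parameter given as a functional of distribution functions on $\mathbb R^d$. Let $\hat F_i^j(z)=\frac1{j-i+1}\sum_{t=i}^j I\{X_t\le z\}$ (component-wise inequality) be the empirical distribution function of $X_i,\dots,X_j$ and $\hat\theta_i^j=\theta(\hat F_i^j)$, which is assumed to be a random variable for all $1\le i\le j$. For every $x\in\mathbb R^d$ the influence function $$\mathcal{IF}(x,F,\theta)=\lim_{\eta\searrow0}\frac{\theta((1-\eta)F+\eta\,\delta_x)-\theta(F)}{\eta},\qquad \delta_x(z)=I\{x\le z\},$$ is assumed to exist, and to be square integrable under the law of $X_0$. Put $\mathcal{IF}_t=\mathcal{IF}(X_t,F_t,\theta)$ and define $R_{i,j}$ by $\hat\theta_i^j-\theta(F)=\frac1{j-i+1}\sum_{t=i}^j\mathcal{IF}(X_t,F,\theta)+R_{i,j}$. Write $|\cdot|$ for the Euclidean norm. Fix an integer $T\ge1$. **Assumptions.** * (Null hypothesis)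 With $\theta_t=\theta(F_t)$, $\theta_1=\dots=\theta_m=\theta_{m+1}=\dots=\theta_{(T+1)m}$ for every $m$. * (Approximation) The long-run variance matrix $\Sigma=\sum_{t\in\mathbb Z}\operatorname{Cov}(\mathcal{IF}_0,\mathcal{IF}_t)\in\mathbb R^{p\times p}$ exists (as the limit of the sums over $-n\le t\le n$) and is non-singular. There is $0<\xi<1/2$ and, for each $m$, there are two independent standard $p$-dimensional Brownian motions $W_{m,1},W_{m,2}$ on the underlying probability space such that, as $m\to\infty$, $$\sup_{k\ge1}\frac1{k^\xi}\Big|\sum_{t=m+1}^{m+k}\mathcal{IF}_t-\sqrt\Sigma\,W_{m,1}(k)\Big|=\mathcal O_{\mathbb P}(1),\qquad \frac1{m^\xi}\Big|\sum_{t=1}^{m}\mathcal{IF}_t-\sqrt\Sigma\,W_{m,2}(m)\Big|=\mathcal O_{\mathbb P}(1).$$ * (Linearization) With probability one, $\max_{1\le i\le j\le k}\frac{j-i+1}{\sqrt k}|R_{i,j}|\to0$ as $k\to\infty$. * (Long-run variance estimator) For each $m$, $\hat\Sigma_m$ is an almost surely non-singular random $p\times p$ matrix, and $\hat\Sigma_m\to\Sigma$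 in probability as $m\to\infty$. Call $w:[0,\infty)\to[0,\infty)$ an *admissible weight function* if $w(t)=\tilde w(t)\,I\{t_w\le t\le T_w\}$ with $t_w\in[0,\infty)$, $T_w\in(0,\infty]$, $t_w\ne T_w$, and $\tilde w:[0,\infty)\to(0,\infty)$ continuous, where in the case $T_w=\infty$ moreover $\limsup_{t\to\infty}t\,\tilde w(t)<\infty$ and $1/\tilde w$ is uniformly continuous. Define the detector $$\hat E_m(k)=m^{-1/2}\max_{0\le j\le k-1}(k-j)\,\big\|\hat\theta_1^{m+j}-\hat\theta_{m+j+1}^{m+k}\big\|_{\hat\Sigma_m^{-1}},\qquad \|v\|_A=(v^\top Av)^{1/2},$$ where $\|v\|_A$ is read as $0$ if $v^\top Av<0$, which cannot occur when $A$ is positive definite. Let $W$ be a standard $p$-dimensional Brownian motion with independent components, on any probability space. **Theorem (closed-end case).** Under these assumptions: 1. For every admissible weight function $w$, as $m\to\infty$, $$\max_{1\le k\le Tm}w(k/m)\,\hat E_m(k)\ \overset{\mathcal D}{\Longrightarrow}\ \sup_{0\le t\le T}\ \max_{0\le s\le t}\,(t+1)\,w(t)\,\Big|W\Big(\frac t{t+1}\Big)-W\Big(\frac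 s{s+1}\Big)\Big|.$$ 2. For all $0\le\gamma<1/2$ and $\varepsilon>0$, this convergence holds for the weight function $w_\gamma(t)=(1+t)^{-1}\max\{(\frac t{1+t})^\gamma,\varepsilon\}^{-1}$ (with $0^0=1$), and its limit satisfies $$\sup_{0\le t\le T}\ \max_{0\le s\le t}\,(t+1)\,w_\gamma(t)\,\Big|W\Big(\frac t{t+1}\Big)-W\Big(\frac s{s+1}\Big)\Big|\ \overset{\mathcal D}{=}\ \max_{0<t\le T/(T+1)}\ \max_{0\le s\le t}\,\frac{|W(t)-W(s)|}{\max\{t^\gamma,\varepsilon\}}.$$ -/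

import Mathlib

open MeasureTheory ProbabilityTheory Filter Topology
open scoped NNReal ENNReal MatrixOrder

namespace Monitoring

noncomputable section

/-- Distribution functions on `ℝ^d` are functions `(Fin d → ℝ) → ℝ`; `≤` is component-wise.
This is the distribution function of the random vector `Y`. -/
def distFun {Ω : Type*} [MeasurableSpace Ω] {d : ℕ} (P : Measure Ω) (Y : Ω → Fin d → ℝ) :
    (Fin d → ℝ) → ℝ :=
  fun z => P.real {ω | Y ω ≤ z}

/-- The distribution function `z ↦ I{x ≤ z}` of the Dirac measure at `x`. -/
def diracDistFun {d : ℕ} (x : Fin d → ℝ) : (Fin d → ℝ) → ℝ :=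
  Set.indicator (Set.Ici x) 1

/-- The empirical distribution function of `X_i, …, X_j`. -/
def empDistFun {Ω : Type*} {d : ℕ} (X : ℤ → Ω → Fin d → ℝ) (i j : ℤ) (ω : Ω) :
    (Fin d → ℝ) → ℝ :=
  fun z => ((j - i + 1 : ℤ) : ℝ)⁻¹ * ∑ t ∈ Finset.Icc i j, diracDistFun (X t ω) z

/-- The estimator `θ̂_i^j = θ(F̂_i^j)`. -/
def estimator {Ω : Type*} {d p : ℕ} (θ : ((Fin d → ℝ) → ℝ) → EuclideanSpace ℝ (Fin p))
    (X : ℤ → Ω → Fin d → ℝ) (i j : ℤ) (ω : Ω) : EuclideanSpace ℝ (Fin p) :=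
  θ (empDistFun X i j ω)

/-- The difference quotient `(θ((1-η)F + η δ_x) - θ(F)) / η`. -/
def influenceQuotient {d p : ℕ} (θ : ((Fin d → ℝ) → ℝ) → EuclideanSpace ℝ (Fin p))
    (F : (Fin d → ℝ) → ℝ) (x : Fin d → ℝ) (η : ℝ) : EuclideanSpace ℝ (Fin p) :=
  η⁻¹ • (θ ((1 - η) • F + η • diracDistFun x) - θ F)

/-- The influence function `IF(x, F, θ)`, the limit of the difference quotient as `η ↘ 0`. Its
existence is required separately, by `InfluenceExists`. -/
def influence {d p : ℕ} (θ : ((Fin d → ℝ) → ℝ) → EuclideanSpace ℝ (Fin p))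
    (F : (Fin d → ℝ) → ℝ) (x : Fin d → ℝ) : EuclideanSpace ℝ (Fin p) :=
  limUnder (𝓝[>] (0 : ℝ)) (influenceQuotient θ F x)

def InfluenceExists {d p : ℕ} (θ : ((Fin d → ℝ) → ℝ) → EuclideanSpace ℝ (Fin p))
    (F : (Fin d → ℝ) → ℝ) : Prop :=
  ∀ x, ∃ v, Tendsto (influenceQuotient θ F x) (𝓝[>] (0 : ℝ)) (𝓝 v)

/-- `IF_t = IF(X_t, F_t, θ)`, with `F_t` the distribution function of `X_t`. -/
def influenceAt {Ω : Type*} [MeasurableSpace Ω] {d p : ℕ} (P : Measure Ω)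
    (θ : ((Fin d → ℝ) → ℝ) → EuclideanSpace ℝ (Fin p)) (X : ℤ → Ω → Fin d → ℝ)
    (t : ℤ) (ω : Ω) : EuclideanSpace ℝ (Fin p) :=
  influence θ (distFun P (X t)) (X t ω)

/-- The remainder `R_{i,j}` of the linearization of `θ̂_i^j` at `F`. -/
def remainder {Ω : Type*} {d p : ℕ} (θ : ((Fin d → ℝ) → ℝ) → EuclideanSpace ℝ (Fin p))
    (F : (Fin d → ℝ) → ℝ) (X : ℤ → Ω → Fin d → ℝ) (i j : ℤ) (ω : Ω) :
    EuclideanSpace ℝ (Fin p) :=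
  estimator θ X i j ω - θ F
    - (((j - i + 1 : ℤ) : ℝ)⁻¹) • ∑ t ∈ Finset.Icc i j, influence θ F (X t ω)

/-- Standard `p`-dimensional Brownian motion with independent components. -/
structure IsStdBrownian {Ω : Type*} [MeasurableSpace Ω] {p : ℕ}
    (W : ℝ≥0 → Ω → EuclideanSpace ℝ (Fin p)) (P : Measure Ω) : Prop where
  brownian : ∀ i, IsBrownianReal (fun t ω => W t ω i) P
  indep : iIndepFun (fun (i : Fin p) (ω : Ω) (t : ℝ≥0) => W t ω i) P

/-- Strict stationarity: the law of the whole process is invariant under time shifts. -/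
def StrictlyStationary {Ω : Type*} [MeasurableSpace Ω] {d : ℕ} (P : Measure Ω)
    (X : ℤ → Ω → Fin d → ℝ) : Prop :=
  ∀ h : ℤ, IdentDistrib (fun ω t => X (t + h) ω) (fun ω t => X t ω) P P

/-- `Y_m = O_P(1)` as `m → ∞`, for `[0,∞]`-valued `Y_m`. -/
def BoundedInProbability {Ω : Type*} [MeasurableSpace Ω] (P : Measure Ω)
    (Y : ℕ → Ω → ℝ≥0∞) : Prop :=
  ∀ δ : ℝ≥0∞, 0 < δ → ∃ C : ℝ≥0, ∀ᶠ m in atTop, P {ω | (C : ℝ≥0∞) < Y m ω} ≤ δ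

/-- `S = ∑_{t ∈ ℤ} Cov(Z_0, Z_t)`, entrywise, as the limit of the partial sums over
`-n ≤ t ≤ n`. -/
def IsLongRunVariance {Ω : Type*} [MeasurableSpace Ω] {p : ℕ} (P : Measure Ω)
    (Z : ℤ → Ω → EuclideanSpace ℝ (Fin p)) (S : Matrix (Fin p) (Fin p) ℝ) : Prop :=
  ∀ a b, Tendsto
    (fun n : ℕ => ∑ t ∈ Finset.Icc (-(n : ℤ)) n, cov[fun ω => Z 0 ω a, fun ω => Z t ω b; P])
    atTop (𝓝 (S a b))

/-- The vector `√S v`, with `√S` the positive semidefinite square root of `S`. -/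
def sqrtMulVec {p : ℕ} (S : Matrix (Fin p) (Fin p) ℝ) (v : EuclideanSpace ℝ (Fin p)) :
    EuclideanSpace ℝ (Fin p) :=
  Matrix.toEuclideanCLM (𝕜 := ℝ) (CFC.sqrt S) v

/-- The approximation assumption, with long-run variance matrix `S`. -/
structure ApproximationAssumption {Ω : Type*} [MeasurableSpace Ω] {d p : ℕ} (P : Measure Ω)
    (θ : ((Fin d → ℝ) → ℝ) → EuclideanSpace ℝ (Fin p)) (X : ℤ → Ω → Fin d → ℝ)
    (S : Matrix (Fin p) (Fin p) ℝ) : Prop where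
  stationary : StrictlyStationary P X
  influence_exists : InfluenceExists θ (distFun P (X 0))
  influence_memLp : MemLp (influence θ (distFun P (X 0))) 2 (P.map (X 0))
  longRunVariance : IsLongRunVariance P (influenceAt P θ X) S
  nonsingular : S.det ≠ 0
  approx : ∃ (ξ : ℝ) (W₁ W₂ : ℕ → ℝ≥0 → Ω → EuclideanSpace ℝ (Fin p)),
    0 < ξ ∧ ξ < 1 / 2 ∧
    (∀ m, IsStdBrownian (W₁ m) P ∧ IsStdBrownian (W₂ m) P ∧
      IndepFun (fun ω t => W₁ m t ω) (fun ω t => W₂ m t ω) P) ∧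
    BoundedInProbability P (fun m ω => ⨆ (k : ℕ) (_ : 1 ≤ k), ENNReal.ofReal
      (((k : ℝ) ^ ξ)⁻¹ * ‖∑ t ∈ Finset.Icc ((m : ℤ) + 1) (m + k), influenceAt P θ X t ω
        - sqrtMulVec S (W₁ m k ω)‖)) ∧
    BoundedInProbability P (fun m ω => ENNReal.ofReal
      (((m : ℝ) ^ ξ)⁻¹ * ‖∑ t ∈ Finset.Icc (1 : ℤ) m, influenceAt P θ X t ω
        - sqrtMulVec S (W₂ m m ω)‖))

/-- The assumption on weight functions `w(t) = w̃(t) I{t_w ≤ t ≤ T_w}`. -/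
def IsWeightFunction (w : ℝ≥0 → ℝ) : Prop :=
  ∃ (w' : ℝ≥0 → ℝ) (tw : ℝ≥0) (Tw : ℝ≥0∞),
    0 < Tw ∧ (tw : ℝ≥0∞) ≠ Tw ∧ Continuous w' ∧ (∀ t, 0 < w' t) ∧
    (∀ t, w t = Set.indicator {t : ℝ≥0 | tw ≤ t ∧ (t : ℝ≥0∞) ≤ Tw} w' t) ∧
    (Tw = ∞ → (∃ C : ℝ, ∀ᶠ t : ℝ≥0 in atTop, (t : ℝ) * w' t ≤ C) ∧
      UniformContinuous (fun t => 1 / w' t))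

/-- The linearization assumption: almost surely
`max_{1 ≤ i ≤ j ≤ k} (j - i + 1) / √k * |R_{i,j}| → 0` as `k → ∞`. -/
def LinearizationAssumption {Ω : Type*} [MeasurableSpace Ω] {d p : ℕ} (P : Measure Ω)
    (θ : ((Fin d → ℝ) → ℝ) → EuclideanSpace ℝ (Fin p)) (X : ℤ → Ω → Fin d → ℝ) : Prop :=
  ∀ᵐ ω ∂P, Tendsto
    (fun k : ℕ => ⨆ (j : Finset.Icc (1 : ℤ) k) (i : Finset.Icc (1 : ℤ) (j : ℤ)),
      ((j - i + 1 : ℤ) : ℝ) / √(k : ℝ) * ‖remainder θ (distFun P (X 0)) X i j ω‖)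
    atTop (𝓝 0)

/-- The null hypothesis `θ_1 = ⋯ = θ_{(T+1)m}` (for every length `m` of the training sample),
where `θ_t = θ(F_t)`. -/
def NullHypothesis {Ω : Type*} [MeasurableSpace Ω] {d p : ℕ} (P : Measure Ω)
    (θ : ((Fin d → ℝ) → ℝ) → EuclideanSpace ℝ (Fin p)) (X : ℤ → Ω → Fin d → ℝ) (T : ℕ) : Prop :=
  ∀ (m : ℕ) (t : ℤ), 1 ≤ t → t ≤ (T + 1) * m → θ (distFun P (X t)) = θ (distFun P (X 1))

/-- `‖v‖_A = (vᵀ A v)^{1/2}`, the norm induced by `A` when `A` is positive definite (and `0` where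
`vᵀ A v < 0`, which can only happen for a matrix `A` that is not positive semidefinite). -/
def weightedNorm {p : ℕ} (A : Matrix (Fin p) (Fin p) ℝ) (v : EuclideanSpace ℝ (Fin p)) : ℝ :=
  √(v.ofLp ⬝ᵥ A.mulVec v.ofLp)

/-- The detector `Ê_m(k)`; `Shat m` is the estimator of the long-run variance matrix. -/
def detector {Ω : Type*} {d p : ℕ} (θ : ((Fin d → ℝ) → ℝ) → EuclideanSpace ℝ (Fin p))
    (X : ℤ → Ω → Fin d → ℝ) (Shat : ℕ → Ω → Matrix (Fin p) (Fin p) ℝ)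
    (m k : ℕ) (ω : Ω) : ℝ :=
  (√(m : ℝ))⁻¹ * ⨆ j : Fin k, ((k : ℝ) - (j : ℕ)) *
    weightedNorm (Shat m ω)⁻¹
      (estimator θ X 1 (m + (j : ℕ)) ω - estimator θ X (m + (j : ℕ) + 1) (m + k) ω)

/-- The closed-end monitoring statistic `max_{k=1}^{Tm} w(k/m) Ê_m(k)`. -/
def closedEndStatistic {Ω : Type*} {d p : ℕ}
    (θ : ((Fin d → ℝ) → ℝ) → EuclideanSpace ℝ (Fin p))
    (X : ℤ → Ω → Fin d → ℝ) (Shat : ℕ → Ω → Matrix (Fin p) (Fin p) ℝ) (w : ℝ≥0 → ℝ)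
    (T m : ℕ) (ω : Ω) : ℝ :=
  ⨆ k : Finset.Icc 1 (T * m), w ((k : ℕ) / (m : ℝ≥0)) * detector θ X Shat m k ω

/-- `sup_{0 ≤ t ≤ T} max_{0 ≤ s ≤ t} (t+1) w(t) |W(t/(t+1)) - W(s/(s+1))|`. -/
def closedEndLimit {Ω : Type*} {p : ℕ} (W : ℝ≥0 → Ω → EuclideanSpace ℝ (Fin p))
    (w : ℝ≥0 → ℝ) (T : ℕ) (ω : Ω) : ℝ :=
  ⨆ (t : Set.Icc (0 : ℝ≥0) T) (s : Set.Icc (0 : ℝ≥0) (t : ℝ≥0)),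
    ((t : ℝ≥0) + 1 : ℝ) * w t *
      ‖W ((t : ℝ≥0) / (t + 1)) ω - W ((s : ℝ≥0) / (s + 1)) ω‖

/-- `w_γ(t) = (1+t)⁻¹ max{(t/(1+t))^γ, ε}⁻¹`. -/
def weightGamma (γ ε : ℝ) (t : ℝ≥0) : ℝ :=
  (1 + (t : ℝ))⁻¹ * (max (((t : ℝ) / (1 + t)) ^ γ) ε)⁻¹

/-- `L_{1,γ}(T) = max_{0 < t ≤ T/(T+1)} max_{0 ≤ s ≤ t} |W(t) - W(s)| / max{t^γ, ε}`. -/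
def limitGamma {Ω : Type*} {p : ℕ} (W : ℝ≥0 → Ω → EuclideanSpace ℝ (Fin p))
    (γ ε : ℝ) (T : ℕ) (ω : Ω) : ℝ :=
  ⨆ (t : Set.Ioc (0 : ℝ≥0) ((T : ℝ≥0) / (T + 1))) (s : Set.Icc (0 : ℝ≥0) (t : ℝ≥0)),
    1 / max (((t : ℝ≥0) : ℝ) ^ γ) ε * ‖W t ω - W s ω‖

end

end Monitoring

open Monitoring

/-! # Closed-end monitoring: weak convergence of the detector under the null hypothesis -/

namespace Monitoring

/-! ### Weighted norms -/

/-! By stationarity every `X_t` has the same distribution function, so all estimators are linearized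
at one `F`. In `(k - j)(θ̂_1^{m+j} - θ̂_{m+j+1}^{m+k})` the constant `θ(F)` cancels, and up to
remainders one is left with `(m+k)/(m+j) S(m+j) - S(m+k)`, where `S(n)` is the sum of the first `n`
influence values (`smul_estimator_sub_eq`). The strong approximation replaces `S(m+k)` by `√Σ (W₂(m)
+ W₁(k))` with error `O(m^ξ) = o(√m)`, and the linearization makes the remainders `o(√m)` as well.
Since `‖√Σ v‖` in the `Σ⁻¹` norm is `|v|`, the statistic is close to the weighted grid maximum of
`(k/m + 1)|U(k) - U(j)|` with `U = drivingPath` (`abs_closedEndStatistic_sub_le`).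

The Brownian part needs no invariance principle. For each fixed `m` a covariance computation shows
that `U` has exactly the law of `W` sampled at the times `t/(t+1)`, `t = k/m`
(`identDistrib_drivingPath`). For a single continuous path of `W` the grid maxima converge to the
supremum over the continuum (`tendsto_gridFunctional`), which gives convergence in distribution.
Slutsky's lemma then finishes part 1.

In part 2 the time change `u = t/(t+1)` makes the two limits agree path by path
(`closedEndLimit_weightGamma`). -/

/-- Needed for all real arguments: the quadratic form of the inverse estimator may be negative,
where `√` is `0`. -/
lemma abs_sqrt_sub_sqrt_le (a b : ℝ) : |√a - √b| ≤ √|a - b| := by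
  wlog h : b ≤ a generalizing a b
  · rw [abs_sub_comm, abs_sub_comm a]
    exact this b a (le_of_not_ge h)
  rw [abs_of_nonneg (sub_nonneg.2 (Real.sqrt_le_sqrt h)), abs_of_nonneg (sub_nonneg.2 h),
    sub_le_iff_le_add]
  rcases le_total b 0 with hb | hb
  · rw [Real.sqrt_eq_zero_of_nonpos hb, add_zero]
    rcases le_total a 0 with ha | ha
    · rw [Real.sqrt_eq_zero_of_nonpos ha]; positivity
    · exact Real.sqrt_le_sqrt (by linarith)
  · refine Real.sqrt_le_iff.2 ⟨by positivity, ?_⟩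
    nlinarith [Real.sq_sqrt hb, Real.sq_sqrt (sub_nonneg.2 h),
      mul_nonneg (Real.sqrt_nonneg (a - b)) (Real.sqrt_nonneg b)]

lemma weightedNorm_eq_sqrt_inner {p : ℕ} (A : Matrix (Fin p) (Fin p) ℝ)
    (v : EuclideanSpace ℝ (Fin p)) :
    weightedNorm A v = √(inner ℝ v (Matrix.toEuclideanCLM (𝕜 := ℝ) A v)) := by
  rw [weightedNorm, Matrix.inner_toEuclideanCLM]

lemma weightedNorm_smul {p : ℕ} (A : Matrix (Fin p) (Fin p) ℝ) {c : ℝ} (hc : 0 ≤ c)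
    (v : EuclideanSpace ℝ (Fin p)) : weightedNorm A (c • v) = c * weightedNorm A v := by
  simp only [weightedNorm_eq_sqrt_inner, map_smul, inner_smul_left, inner_smul_right]
  rw [← mul_assoc, Real.sqrt_mul (by simpa using mul_self_nonneg c)]
  simp [Real.sqrt_mul_self hc]

lemma abs_weightedNorm_sub_le {p : ℕ} (A B : Matrix (Fin p) (Fin p) ℝ)
    (x y : EuclideanSpace ℝ (Fin p)) :
    |weightedNorm A x - weightedNorm B y| ≤
      √(‖Matrix.toEuclideanCLM (𝕜 := ℝ) (A - B)‖ * ‖x‖ ^ 2 +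
        ‖Matrix.toEuclideanCLM (𝕜 := ℝ) B‖ * ‖x - y‖ * (‖x‖ + ‖y‖)) := by
  simp only [weightedNorm_eq_sqrt_inner]
  refine (abs_sqrt_sub_sqrt_le _ _).trans (Real.sqrt_le_sqrt ?_)
  set f := Matrix.toEuclideanCLM (n := Fin p) (𝕜 := ℝ)
  -- `B` need not be symmetric, so `x - y` is split off on each side of the form in turn.
  have h : inner ℝ x (f A x) - inner ℝ y (f B y) =
      inner ℝ x (f (A - B) x) + (inner ℝ (x - y) (f B x) + inner ℝ y (f B (x - y))) := by
    simp only [map_sub, sub_apply, inner_sub_left, inner_sub_right]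
    ring
  rw [h]
  have h1 (C : EuclideanSpace ℝ (Fin p) →L[ℝ] EuclideanSpace ℝ (Fin p))
      (u v : EuclideanSpace ℝ (Fin p)) : |inner ℝ u (C v)| ≤ ‖C‖ * ‖u‖ * ‖v‖ := by
    refine (abs_real_inner_le_norm _ _).trans ?_
    rw [mul_comm ‖C‖, mul_assoc]
    gcongr
    exact C.le_opNorm v
  refine (abs_add_le _ _).trans (add_le_add ?_ ((abs_add_le _ _).trans ?_))
  · exact (h1 _ x x).trans_eq (by ring)
  · exact (add_le_add (h1 _ _ _) (h1 _ _ _)).trans_eq (by ring)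

/-- The square root is symmetric and `√S S⁻¹ √S = 1`. This is what removes the long-run variance
from the limit. -/
lemma weightedNorm_inv_sqrtMulVec {p : ℕ} {S : Matrix (Fin p) (Fin p) ℝ} (hS : 0 ≤ S)
    (hdet : S.det ≠ 0) (v : EuclideanSpace ℝ (Fin p)) :
    weightedNorm S⁻¹ (sqrtMulVec S v) = ‖v‖ := by
  have hsq : CFC.sqrt S * CFC.sqrt S = S := CFC.sqrt_mul_sqrt_self S hS
  have hsymm : (CFC.sqrt S).transpose = CFC.sqrt S := by
    have h := (Matrix.nonneg_iff_posSemidef.1 (CFC.sqrt_nonneg S)).isHermitian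
    rwa [Matrix.IsHermitian, Matrix.conjTranspose_eq_transpose_of_trivial] at h
  have hu : IsUnit (CFC.sqrt S).det := by
    rw [isUnit_iff_ne_zero]
    intro h0
    apply hdet
    rw [← hsq, Matrix.det_mul, h0, zero_mul]
  have hinv : CFC.sqrt S * S⁻¹ * CFC.sqrt S = 1 := by
    nth_rewrite 2 [← hsq]
    rw [Matrix.mul_inv_rev, ← mul_assoc, Matrix.mul_nonsing_inv _ hu, one_mul,
      Matrix.nonsing_inv_mul _ hu]
  rw [weightedNorm, sqrtMulVec, Matrix.ofLp_toEuclideanCLM, Matrix.mulVec_mulVec,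
    ← Matrix.vecMul_transpose, hsymm, ← Matrix.dotProduct_mulVec, Matrix.mulVec_mulVec, ← mul_assoc,
    hinv, Matrix.one_mulVec, EuclideanSpace.norm_eq]
  simp [dotProduct, sq]

/-- Inversion is continuous at a nonsingular matrix. The entrywise form matches the entrywise
consistency of the estimator. -/
lemma exists_forall_abs_sub_lt_norm_inv_sub_lt {p : ℕ} {S : Matrix (Fin p) (Fin p) ℝ}
    (hdet : S.det ≠ 0) {ε : ℝ} (hε : 0 < ε) :
    ∃ η > 0, ∀ M : Matrix (Fin p) (Fin p) ℝ, (∀ a b, |M a b - S a b| < η) →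
      ‖Matrix.toEuclideanCLM (𝕜 := ℝ) (M⁻¹ - S⁻¹)‖ < ε := by
  have h1 : ContinuousAt (fun M : Matrix (Fin p) (Fin p) ℝ => M⁻¹) S := by
    simp only [Matrix.inv_def, Ring.inverse_eq_inv']
    exact ((continuous_id.matrix_det.continuousAt).inv₀ hdet).smul
      continuous_id.matrix_adjugate.continuousAt
  let L : Matrix (Fin p) (Fin p) ℝ →ₗ[ℝ]
      (EuclideanSpace ℝ (Fin p) →L[ℝ] EuclideanSpace ℝ (Fin p)) :=
    (Matrix.toEuclideanCLM (n := Fin p) (𝕜 := ℝ)).toAlgEquiv.toLinearMap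
  have hL : Continuous L := L.continuous_of_finiteDimensional
  have h2 : Tendsto (fun M : Matrix (Fin p) (Fin p) ℝ => ‖L (M⁻¹ - S⁻¹)‖) (𝓝 S) (𝓝 0) := by
    have := (hL.norm.continuousAt (x := S⁻¹ - S⁻¹)).tendsto.comp
      (h1.tendsto.sub (tendsto_const_nhds (x := S⁻¹)))
    simpa [Function.comp_def] using this
  have h3 : ∀ᶠ M : Matrix (Fin p) (Fin p) ℝ in 𝓝 S, ‖L (M⁻¹ - S⁻¹)‖ < ε :=
    h2.eventually_lt_const hε
  -- Passing to functions gives access to the sup metric, whose balls are entrywise bounds.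
  have h4 : ∀ᶠ M : Fin p → Fin p → ℝ in 𝓝 (fun a b => S a b),
      ‖L ((Matrix.of M)⁻¹ - S⁻¹)‖ < ε := h3
  obtain ⟨η, hη, h⟩ := Metric.eventually_nhds_iff.1 h4
  refine ⟨η, hη, fun M hM => h (y := fun a b => M a b) ?_⟩
  exact (dist_pi_lt_iff hη).2 fun a => (dist_pi_lt_iff hη).2 fun b => hM a b

/-! ### Weighted maxima over a triangular grid -/

/-- The maximum of `w k * H k j` over `1 ≤ k ≤ n` and `0 ≤ j < k`. -/
noncomputable def gridMax (n : ℕ) (w : ℕ → ℝ) (H : ℕ → ℕ → ℝ) : ℝ :=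
  ⨆ k : Finset.Icc 1 n, w k * ⨆ j : Fin k, H k j

lemma gridMax_le {n : ℕ} {w : ℕ → ℝ} {H : ℕ → ℕ → ℝ} (hw : ∀ k, 0 ≤ w k) {a : ℝ} (ha : 0 ≤ a)
    (h : ∀ k j, 1 ≤ k → k ≤ n → j < k → w k * H k j ≤ a) : gridMax n w H ≤ a := by
  refine Real.iSup_le (fun k => ?_) ha
  rw [Real.mul_iSup_of_nonneg (hw k)]
  have hk := Finset.mem_Icc.1 k.2
  exact Real.iSup_le (fun j => h k j hk.1 hk.2 j.2) ha

lemma le_gridMax {n : ℕ} {w : ℕ → ℝ} {H : ℕ → ℕ → ℝ} (hw : ∀ k, 0 ≤ w k) {k j : ℕ}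
    (hk : 1 ≤ k) (hkn : k ≤ n) (hj : j < k) : w k * H k j ≤ gridMax n w H := by
  refine le_trans ?_ (le_ciSup (f := fun k : Finset.Icc 1 n => w k * ⨆ j : Fin k, H k j)
    (Set.finite_range _).bddAbove ⟨k, Finset.mem_Icc.2 ⟨hk, hkn⟩⟩)
  exact mul_le_mul_of_nonneg_left (le_ciSup (f := fun j : Fin k => H k j)
    (Set.finite_range _).bddAbove ⟨j, hj⟩) (hw k)

lemma gridMax_nonneg {n : ℕ} {w : ℕ → ℝ} {H : ℕ → ℕ → ℝ} (hw : ∀ k, 0 ≤ w k)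
    (hH : ∀ k j, 0 ≤ H k j) : 0 ≤ gridMax n w H :=
  Real.iSup_nonneg fun k => mul_nonneg (hw k) (Real.iSup_nonneg fun _ => hH k _)

lemma gridMax_le_add {n : ℕ} {w : ℕ → ℝ} {H H' : ℕ → ℕ → ℝ} (hw : ∀ k, 0 ≤ w k)
    (hH' : ∀ k j, 0 ≤ H' k j) {C ε : ℝ} (hC : 0 ≤ C) (hwC : ∀ k ≤ n, w k ≤ C) (hε : 0 ≤ ε)
    (h : ∀ k j, 1 ≤ k → k ≤ n → j < k → |H k j - H' k j| ≤ ε) :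
    gridMax n w H ≤ gridMax n w H' + C * ε := by
  refine gridMax_le hw (add_nonneg (gridMax_nonneg hw hH') (mul_nonneg hC hε))
    fun k j hk hkn hj => ?_
  have h1 := le_gridMax (H := H') hw hk hkn hj
  have h2 : H k j ≤ H' k j + ε := by linarith [(abs_le.1 (h k j hk hkn hj)).2]
  calc w k * H k j ≤ w k * (H' k j + ε) := mul_le_mul_of_nonneg_left h2 (hw k)
    _ = w k * H' k j + w k * ε := mul_add _ _ _
    _ ≤ _ := add_le_add h1 (mul_le_mul_of_nonneg_right (hwC k hkn) hε)

lemma abs_gridMax_sub_le {n : ℕ} {w : ℕ → ℝ} {H H' : ℕ → ℕ → ℝ} (hw : ∀ k, 0 ≤ w k)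
    (hH : ∀ k j, 0 ≤ H k j) (hH' : ∀ k j, 0 ≤ H' k j) {C ε : ℝ} (hC : 0 ≤ C)
    (hwC : ∀ k ≤ n, w k ≤ C) (hε : 0 ≤ ε)
    (h : ∀ k j, 1 ≤ k → k ≤ n → j < k → |H k j - H' k j| ≤ ε) :
    |gridMax n w H - gridMax n w H'| ≤ C * ε := by
  rw [abs_le]
  constructor
  · have := gridMax_le_add hw hH hC hwC hε (H := H')
      fun k j hk hkn hj => by rw [abs_sub_comm]; exact h k j hk hkn hj
    linarith
  · linarith [gridMax_le_add hw hH' hC hwC hε h]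

lemma aemeasurable_gridMax {Ω : Type*} [MeasurableSpace Ω] {P : Measure Ω} {n : ℕ} (w : ℕ → ℝ)
    {H : ℕ → ℕ → Ω → ℝ} (h : ∀ k j, 1 ≤ k → k ≤ n → j < k → AEMeasurable (H k j) P) :
    AEMeasurable (fun ω => gridMax n w (fun k j => H k j ω)) P := by
  refine AEMeasurable.iSup fun k => AEMeasurable.const_mul (AEMeasurable.iSup fun j => ?_) _
  have hk := Finset.mem_Icc.1 k.2
  exact h k j hk.1 hk.2 j.2

/-! ### The long-run variance matrix is positive semidefinite -/

lemma StrictlyStationary.identDistrib_pair {Ω : Type*} [MeasurableSpace Ω] {d : ℕ} {P : Measure Ω}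
    {X : ℤ → Ω → Fin d → ℝ} (h : StrictlyStationary P X) (s t : ℤ) :
    IdentDistrib (fun ω => (X s ω, X t ω)) (fun ω => (X 0 ω, X (t - s) ω)) P P := by
  have := (h s).comp (u := fun x : ℤ → Fin d → ℝ => (x 0, x (t - s))) (by fun_prop)
  simpa [Function.comp_def] using this

lemma StrictlyStationary.identDistrib {Ω : Type*} [MeasurableSpace Ω] {d : ℕ} {P : Measure Ω}
    {X : ℤ → Ω → Fin d → ℝ} (h : StrictlyStationary P X) (t : ℤ) :
    IdentDistrib (X t) (X 0) P P :=
  (h.identDistrib_pair t t).comp measurable_fst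

lemma StrictlyStationary.distFun_eq {Ω : Type*} [MeasurableSpace Ω] {d : ℕ} {P : Measure Ω}
    {X : ℤ → Ω → Fin d → ℝ} (h : StrictlyStationary P X) (t : ℤ) :
    distFun P (X t) = distFun P (X 0) := by
  funext z
  exact congrArg ENNReal.toReal ((h.identDistrib t).measure_mem_eq measurableSet_Iic)

lemma influenceAt_eq {Ω : Type*} [MeasurableSpace Ω] {d p : ℕ} {P : Measure Ω}
    {θ : ((Fin d → ℝ) → ℝ) → EuclideanSpace ℝ (Fin p)} {X : ℤ → Ω → Fin d → ℝ}
    (h : StrictlyStationary P X) (t : ℤ) (ω : Ω) :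
    influenceAt P θ X t ω = influence θ (distFun P (X 0)) (X t ω) := by
  rw [influenceAt, h.distFun_eq]

lemma memLp_comp_of_stationary {Ω : Type*} [MeasurableSpace Ω] {d p : ℕ} {P : Measure Ω}
    {X : ℤ → Ω → Fin d → ℝ} (h : StrictlyStationary P X)
    {g : (Fin d → ℝ) → EuclideanSpace ℝ (Fin p)} (hg : MemLp g 2 (P.map (X 0))) (t : ℤ) :
    MemLp (fun ω => g (X t ω)) 2 P := by
  rw [← (h.identDistrib t).map_eq] at hg
  exact (memLp_map_measure_iff hg.1 (h.identDistrib t).aemeasurable_fst).1 hg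

/-- A covariance depends only on the joint law of the pair, which is shift invariant. As `g` is
measurable only up to null sets of the marginal law, its measurability under the joint law is
obtained through the two projections. -/
lemma covariance_comp_of_stationary {Ω : Type*} [MeasurableSpace Ω] {d p : ℕ} {P : Measure Ω}
    {X : ℤ → Ω → Fin d → ℝ} (h : StrictlyStationary P X)
    {g : (Fin d → ℝ) → EuclideanSpace ℝ (Fin p)} (hg : MemLp g 2 (P.map (X 0))) (a b : Fin p)
    (s t : ℤ) :
    cov[fun ω => g (X s ω) a, fun ω => g (X t ω) b; P] =
      cov[fun ω => g (X 0 ω) a, fun ω => g (X (t - s) ω) b; P] := by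
  have key (s t : ℤ) : cov[fun ω => g (X s ω) a, fun ω => g (X t ω) b; P] =
      cov[fun x : (Fin d → ℝ) × (Fin d → ℝ) => g x.1 a, fun x => g x.2 b;
        P.map (fun ω => (X s ω, X t ω))] := by
    have hs := (h.identDistrib s).aemeasurable_fst
    have ht := (h.identDistrib t).aemeasurable_fst
    have hgm (c : Fin p) (r : ℤ) : AEStronglyMeasurable (fun x => g x c) (P.map (X r)) := by
      rw [(h.identDistrib r).map_eq]
      exact (EuclideanSpace.proj (𝕜 := ℝ) c).continuous.comp_aestronglyMeasurable hg.1
    rw [covariance_map_fun]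
    · refine AEStronglyMeasurable.comp_aemeasurable (f := Prod.fst) (g := fun x => g x a) ?_
        measurable_fst.aemeasurable
      rw [AEMeasurable.map_map_of_aemeasurable measurable_fst.aemeasurable (hs.prodMk ht)]
      exact hgm a s
    · refine AEStronglyMeasurable.comp_aemeasurable (f := Prod.snd) (g := fun x => g x b) ?_
        measurable_snd.aemeasurable
      rw [AEMeasurable.map_map_of_aemeasurable measurable_snd.aemeasurable (hs.prodMk ht)]
      exact hgm b t
    · exact hs.prodMk ht
  rw [key, key, (h.identDistrib_pair s t).map_eq]

lemma sum_Icc_neg_succ (γ : ℤ → ℝ) (n : ℕ) :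
    ∑ h ∈ Finset.Icc (-((n + 1 : ℕ) : ℤ)) ((n + 1 : ℕ) : ℤ), γ h =
      ∑ h ∈ Finset.Icc (-(n : ℤ)) n, γ h + γ (n + 1) + γ (-(n + 1)) := by
  have : Finset.Icc (-((n + 1 : ℕ) : ℤ)) ((n + 1 : ℕ) : ℤ) =
      insert (-(n + 1 : ℤ)) (insert (n + 1 : ℤ) (Finset.Icc (-(n : ℤ)) n)) := by
    ext x
    simp only [Finset.mem_insert, Finset.mem_Icc]
    push_cast
    omega
  rw [this, Finset.sum_insert, Finset.sum_insert]
  · ring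
  · simp
  · simp only [Finset.mem_insert, Finset.mem_Icc]
    omega

/-- These are the entries that a Toeplitz array `γ (t - s)` gains when it grows from size `n` to `n
+ 1`: a row, a column and the corner. -/
lemma sum_border_eq (γ : ℤ → ℝ) (n : ℕ) :
    ∑ s ∈ Finset.range n, (γ ((n : ℤ) - s) + γ ((s : ℤ) - n)) + γ 0 =
      ∑ h ∈ Finset.Icc (-(n : ℤ)) n, γ h := by
  induction n with
  | zero => simp
  | succ n ih =>
    rw [sum_Icc_neg_succ, ← ih, Finset.sum_range_succ']
    push_cast
    simp only [add_sub_add_right_eq_sub, sub_zero, zero_sub]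
    ring

lemma sum_sum_sub_eq (γ : ℤ → ℝ) (n : ℕ) :
    ∑ s ∈ Finset.range n, ∑ t ∈ Finset.range n, γ ((t : ℤ) - s) =
      ∑ k ∈ Finset.range n, ∑ h ∈ Finset.Icc (-(k : ℤ)) k, γ h := by
  induction n with
  | zero => simp
  | succ n ih =>
    rw [Finset.sum_range_succ (fun k : ℕ => ∑ h ∈ Finset.Icc (-(k : ℤ)) k, γ h), ← ih,
      ← sum_border_eq, Finset.sum_range_succ]
    simp only [Finset.sum_range_succ, Finset.sum_add_distrib, sub_self]
    ring

/-- By `sum_sum_sub_eq`, `Var(Y_0 + ⋯ + Y_{n-1}) / n` is the Cesàro mean of the symmetric partial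
sums of `γ`. It is nonnegative and has the same limit `l`. -/
lemma nonneg_of_tendsto_sum_covariance {Ω : Type*} [MeasurableSpace Ω] {P : Measure Ω}
    [IsProbabilityMeasure P] {Y : ℤ → Ω → ℝ} (hY : ∀ t, MemLp (Y t) 2 P) {γ : ℤ → ℝ}
    (hγ : ∀ s t, cov[Y s, Y t; P] = γ (t - s)) {l : ℝ}
    (hl : Tendsto (fun n : ℕ => ∑ h ∈ Finset.Icc (-(n : ℤ)) n, γ h) atTop (𝓝 l)) : 0 ≤ l := by
  refine ge_of_tendsto' hl.cesaro fun n => mul_nonneg (by positivity) ?_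
  rw [← sum_sum_sub_eq]
  have : ∑ s ∈ Finset.range n, ∑ t ∈ Finset.range n, γ ((t : ℤ) - s) =
      cov[∑ s ∈ Finset.range n, Y s, ∑ s ∈ Finset.range n, Y s; P] := by
    rw [covariance_sum_sum' (X := fun s : ℕ => Y s) (Y := fun s : ℕ => Y s) (fun i _ => hY i)
      (fun i _ => hY i)]
    simp only [hγ]
  rw [this, covariance_self]
  · exact variance_nonneg _ _
  · exact (memLp_finsetSum' (f := fun s : ℕ => Y s) _ fun i _ => hY i).1.aemeasurable

/-- Symmetry comes from reflecting the lag. The quadratic form at `v` is the long-run variance of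
the scalar series `v · g(X_t)`. -/
lemma IsLongRunVariance.nonneg {Ω : Type*} [MeasurableSpace Ω] {d p : ℕ} {P : Measure Ω}
    [IsProbabilityMeasure P] {X : ℤ → Ω → Fin d → ℝ} (h : StrictlyStationary P X)
    {g : (Fin d → ℝ) → EuclideanSpace ℝ (Fin p)} (hg : MemLp g 2 (P.map (X 0)))
    {S : Matrix (Fin p) (Fin p) ℝ} (hS : IsLongRunVariance P (fun t ω => g (X t ω)) S) :
    0 ≤ S := by
  set r : Fin p → Fin p → ℤ → ℝ := fun a b t => cov[fun ω => g (X 0 ω) a, fun ω => g (X t ω) b; P]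
    with hr
  have hrs (a b : Fin p) (s t : ℤ) : cov[fun ω => g (X s ω) a, fun ω => g (X t ω) b; P] =
      r a b (t - s) := covariance_comp_of_stationary h hg a b s t
  have hmem (t : ℤ) (a : Fin p) : MemLp (fun ω => g (X t ω) a) 2 P :=
    (memLp_comp_of_stationary h hg t).continuousLinearMap_comp (EuclideanSpace.proj (𝕜 := ℝ) a)
  refine Matrix.nonneg_iff_posSemidef.2 (Matrix.PosSemidef.of_dotProduct_mulVec_nonneg ?_ ?_)
  · ext a b
    rw [Matrix.conjTranspose_apply, star_trivial]
    refine tendsto_nhds_unique (hS b a) ((hS a b).congr fun n => ?_)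
    refine Finset.sum_equiv (Equiv.neg ℤ) (by simp [and_comm, neg_le]) fun t _ => ?_
    -- A shift by `t` and a swap of the arguments turn `r a b t` into `r b a (-t)`.
    have := hrs a b (-t) 0
    rw [zero_sub, neg_neg, covariance_comm] at this
    exact this.symm
  · intro v
    refine nonneg_of_tendsto_sum_covariance (P := P)
      (Y := fun t ω => ∑ a, v a * g (X t ω) a) (γ := fun t => ∑ a, ∑ b, v a * (v b * r a b t))
      (fun t => memLp_finsetSum _ fun a _ => (hmem t a).const_mul _) (fun s t => ?_) ?_
    · rw [covariance_fun_sum_fun_sum (fun a => (hmem s a).const_mul _)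
        (fun a => (hmem t a).const_mul _)]
      refine Finset.sum_congr rfl fun a _ => Finset.sum_congr rfl fun b _ => ?_
      rw [covariance_const_mul_left, covariance_const_mul_right, hrs]
    · have hlim : Tendsto (fun n : ℕ => ∑ a, ∑ b, v a * (v b *
          ∑ t ∈ Finset.Icc (-(n : ℤ)) n, r a b t)) atTop (𝓝 (∑ a, ∑ b, v a * (v b * S a b))) :=
        tendsto_finsetSum _ fun a _ => tendsto_finsetSum _ fun b _ =>
          ((hS a b).const_mul _).const_mul _
      have e : star v ⬝ᵥ S.mulVec v = ∑ a, ∑ b, v a * (v b * S a b) := by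
        simp only [dotProduct, Matrix.mulVec, Finset.mul_sum, Pi.star_apply, star_trivial]
        refine Finset.sum_congr rfl fun a _ => Finset.sum_congr rfl fun b _ => by ring
      rw [e]
      refine hlim.congr fun n => ?_
      simp only [Finset.mul_sum]
      rw [Finset.sum_comm' (t' := Finset.univ) (s' := fun _ => Finset.Icc (-(n : ℤ)) n) (by simp)]
      refine Finset.sum_congr rfl fun a _ => ?_
      rw [Finset.sum_comm]

/-! ### The law of the limiting Gaussian process along a sequence of times -/

/-- A Brownian motion obtained by gluing the bridge-type process
`u ↦ u B₂(1) - (1 - u) B₁(u / (1 - u))` on `[0, 1]` with `B₂` on `[1, ∞)`. -/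
lemma isPreBrownianReal_glue {Ω : Type*} [MeasurableSpace Ω] {P : Measure Ω}
    {B₁ B₂ : ℝ≥0 → Ω → ℝ} (h₁ : IsPreBrownianReal B₁ P) (h₂ : IsPreBrownianReal B₂ P)
    (hind : IndepFun (fun ω t => B₁ t ω) (fun ω t => B₂ t ω) P) :
    IsPreBrownianReal (fun u ω => ((min u 1 : ℝ≥0) : ℝ) * B₂ (max u 1) ω -
      ((1 - u : ℝ≥0) : ℝ) * B₁ (u / (1 - u)) ω) P := by
  have hP : IsProbabilityMeasure P := (IsPreBrownianReal.isGaussianProcess h₁).isProbabilityMeasure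
  have g₁ : IsGaussianProcess (fun (u : ℝ≥0) ω => ((1 - u : ℝ≥0) : ℝ) * B₁ (u / (1 - u)) ω) P :=
    ((IsPreBrownianReal.isGaussianProcess h₁).comp_right (fun u : ℝ≥0 => u / (1 - u))).smul
      fun u : ℝ≥0 => ((1 - u : ℝ≥0) : ℝ)
  have g₂ : IsGaussianProcess (fun (u : ℝ≥0) ω => ((min u 1 : ℝ≥0) : ℝ) * B₂ (max u 1) ω) P :=
    ((IsPreBrownianReal.isGaussianProcess h₂).comp_right (fun u : ℝ≥0 => max u 1)).smul
      fun u : ℝ≥0 => ((min u 1 : ℝ≥0) : ℝ)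
  have m₁ (t : ℝ≥0) : MemLp (B₁ t) 2 P :=
    ((IsPreBrownianReal.isGaussianProcess h₁).hasGaussianLaw_eval t).memLp_two
  have m₂ (t : ℝ≥0) : MemLp (B₂ t) 2 P :=
    ((IsPreBrownianReal.isGaussianProcess h₂).hasGaussianLaw_eval t).memLp_two
  have c₁₂ (s t : ℝ≥0) : cov[B₁ s, B₂ t; P] = 0 :=
    (hind.comp (measurable_pi_apply s) (measurable_pi_apply t)).covariance_eq_zero (m₁ s) (m₂ t)
  refine IsGaussianProcess.isPreBrownianReal_of_covariance ⟨fun I => ?_⟩ (fun t => ?_)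
    fun s t hst => ?_
  · refine HasGaussianLaw.fun_sub (IndepFun.hasGaussianLaw (g₂.hasGaussianLaw I)
      (g₁.hasGaussianLaw I) ?_)
    refine (hind.comp (φ := fun f : ℝ≥0 → ℝ => I.restrict fun u : ℝ≥0 =>
      ((1 - u : ℝ≥0) : ℝ) * f (u / (1 - u))) (ψ := fun f : ℝ≥0 → ℝ => I.restrict fun u : ℝ≥0 =>
      ((min u 1 : ℝ≥0) : ℝ) * f (max u 1)) ?_ ?_).symm
    · exact measurable_pi_lambda _ fun i => (measurable_pi_apply _).const_mul _
    · exact measurable_pi_lambda _ fun i => (measurable_pi_apply _).const_mul _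
  · rw [integral_sub ((h₂.integrable_eval _).const_mul _) ((h₁.integrable_eval _).const_mul _),
      integral_const_mul, integral_const_mul, h₁.integral_eval, h₂.integral_eval]
    simp
  · rw [covariance_fun_sub_fun_sub ((m₂ _).const_mul _) ((m₁ _).const_mul _)
      ((m₂ _).const_mul _) ((m₁ _).const_mul _)]
    simp only [covariance_const_mul_left, covariance_const_mul_right]
    rw [covariance_comm (B₂ _) (B₁ _)]
    simp only [c₁₂]
    have e₁ := h₁.covariance_eval (s / (1 - s)) (t / (1 - t))
    have e₂ := h₂.covariance_eval (max s 1) (max t 1)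
    rw [e₁, e₂, min_eq_left (max_le_max_right 1 hst)]
    -- For `t < 1` the two parts contribute `t s` and `(1 - t) s`. For `t ≥ 1` truncated subtraction
    -- gives `1 - t = 0`, and the `B₂` part alone gives `s`.
    have key : min s 1 * (min t 1 * max s 1) + (1 - s) * ((1 - t) * min (s / (1 - s)) (t / (1 - t)))
        = s := by
      have hms : min s 1 * max s 1 = s := by rw [min_mul_max, mul_one]
      have h1 : min s 1 * (min t 1 * max s 1) = min t 1 * s := by
        rw [mul_left_comm, hms]
      rw [h1]
      rcases le_or_gt 1 t with ht | ht
      · rw [min_eq_right ht, tsub_eq_zero_of_le ht]; simp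
      · have hs : s < 1 := hst.trans_lt ht
        have hs' : 1 - s ≠ 0 := (tsub_pos_of_lt hs).ne'
        have hle : s / (1 - s) ≤ t / (1 - t) :=
          div_le_div₀ zero_le hst (tsub_pos_of_lt ht) (tsub_le_tsub_left hst 1)
        rw [min_eq_left ht.le, min_eq_left hle]
        calc t * s + (1 - s) * ((1 - t) * (s / (1 - s)))
            = t * s + (1 - t) * s := by field_simp
          _ = (t + (1 - t)) * s := by ring
          _ = s := by rw [add_tsub_cancel_of_le ht.le, one_mul]
    have key' := congrArg (fun x : ℝ≥0 => (x : ℝ)) key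
    push_cast at key'
    push_cast
    linarith

/-- Finite-dimensional laws determine the law of a sequence, by uniqueness of projective limits. -/
lemma IsPreBrownianReal.identDistrib_comp {Ω Ω' : Type*} [MeasurableSpace Ω] [MeasurableSpace Ω']
    {P : Measure Ω} {P' : Measure Ω'} {B : ℝ≥0 → Ω → ℝ} {B' : ℝ≥0 → Ω' → ℝ}
    (h : IsPreBrownianReal B P) (h' : IsPreBrownianReal B' P') (u : ℕ → ℝ≥0) :
    IdentDistrib (fun ω k => B (u k) ω) (fun ω k => B' (u k) ω) P P' := by
  have hP : IsProbabilityMeasure P := (IsPreBrownianReal.isGaussianProcess h).isProbabilityMeasure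
  have hP' : IsProbabilityMeasure P' :=
    (IsPreBrownianReal.isGaussianProcess h').isProbabilityMeasure
  have hm : AEMeasurable (fun ω k => B (u k) ω) P :=
    aemeasurable_pi_lambda _ fun k => h.aemeasurable _
  have hm' : AEMeasurable (fun ω k => B' (u k) ω) P' :=
    aemeasurable_pi_lambda _ fun k => h'.aemeasurable _
  refine ⟨hm, hm', ?_⟩
  have e (I : Finset ℕ) : P.map (fun ω => I.restrict (fun k => B (u k) ω)) =
      P'.map (fun ω => I.restrict (fun k => B' (u k) ω)) := by
    classical
    -- `u` may repeat values, so the marginal over `I` is read off from the one over the finite set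
    -- `u(I)`.
    have hr : Measurable (fun (x : I.image u → ℝ) (i : I) =>
        x ⟨u i, Finset.mem_image_of_mem u i.2⟩) :=
      measurable_pi_lambda _ fun i => measurable_pi_apply _
    exact (((h.hasLaw (I.image u)).identDistrib (h'.hasLaw (I.image u))).comp hr).map_eq
  have l' := isProjectiveLimit_map hm'
  simp_rw [← e] at l'
  exact (isProjectiveLimit_map hm).unique l'

/-- Two independent families, each with independent members, combine componentwise into a family
of independent members. -/
lemma identDistrib_of_iIndepFun_prod {Ω Ω' : Type*} [MeasurableSpace Ω] [MeasurableSpace Ω']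
    {P : Measure Ω} {P' : Measure Ω'} [IsProbabilityMeasure P] [IsProbabilityMeasure P'] {p : ℕ}
    {α β γ : Type*} [MeasurableSpace α] [MeasurableSpace β] [MeasurableSpace γ]
    {f : Fin p → Ω → α} {g : Fin p → Ω → β} {h : Fin p → Ω' → γ}
    (hfm : ∀ a, AEMeasurable (f a) P) (hgm : ∀ a, AEMeasurable (g a) P)
    (hf : iIndepFun f P) (hg : iIndepFun g P) (hh : iIndepFun h P')
    (hfg : IndepFun (fun ω a => f a ω) (fun ω a => g a ω) P)
    {φ : α × β → γ} (hφ : Measurable φ)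
    (hlaw : ∀ a, IdentDistrib (fun ω => φ (f a ω, g a ω)) (h a) P P') :
    IdentDistrib (fun ω a => φ (f a ω, g a ω)) (fun ω a => h a ω) P P' := by
  have hhm (a : Fin p) : AEMeasurable (h a) P' := (hlaw a).aemeasurable_snd
  have hfm' : AEMeasurable (fun ω a => f a ω) P := aemeasurable_pi_lambda _ hfm
  have hgm' : AEMeasurable (fun ω a => g a ω) P := aemeasurable_pi_lambda _ hgm
  have pf (a) : IsProbabilityMeasure (P.map (f a)) := Measure.isProbabilityMeasure_map (hfm a)
  have pg (a) : IsProbabilityMeasure (P.map (g a)) := Measure.isProbabilityMeasure_map (hgm a)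
  refine ⟨aemeasurable_pi_lambda _ fun a => (hlaw a).aemeasurable_fst,
    aemeasurable_pi_lambda _ hhm, ?_⟩
  -- Independence between the two families and within each of them makes the law of the pairs a
  -- product over `a`.
  have hpair : P.map (fun ω a => (f a ω, g a ω)) =
      Measure.pi fun a => (P.map (f a)).prod (P.map (g a)) := by
    have e := (measurePreserving_arrowProdEquivProdArrow α β (Fin p) (fun a => P.map (f a))
      (fun a => P.map (g a)))
    rw [← e.symm.map_eq, ← hf.map_fun_eq_pi_map hfm, ← hg.map_fun_eq_pi_map hgm,
      ← hfg.map_prod_eq_prod_map_map hfm' hgm', AEMeasurable.map_map_of_aemeasurable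
        (MeasurableEquiv.measurable _).aemeasurable (hfm'.prodMk hgm')]
    rfl
  have hc (a : Fin p) : ((P.map (f a)).prod (P.map (g a))).map φ = P'.map (h a) := by
    have hi : IndepFun (f a) (g a) P :=
      hfg.comp (measurable_pi_apply a) (measurable_pi_apply a)
    rw [← hi.map_prod_eq_prod_map_map (hfm a) (hgm a),
      AEMeasurable.map_map_of_aemeasurable hφ.aemeasurable ((hfm a).prodMk (hgm a))]
    exact (hlaw a).map_eq
  have hs (a : Fin p) : SigmaFinite (((P.map (f a)).prod (P.map (g a))).map φ) := by
    have := Measure.isProbabilityMeasure_map (hhm a)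
    rw [hc]; infer_instance
  rw [hh.map_fun_eq_pi_map hhm]
  simp_rw [← hc]
  rw [← Measure.pi_map_pi (f := fun _ => φ) fun a => hφ.aemeasurable, ← hpair,
    AEMeasurable.map_map_of_aemeasurable _
      (aemeasurable_pi_lambda _ fun a => (hfm a).prodMk (hgm a))]
  · rfl
  · exact (measurable_pi_lambda _ fun a => hφ.comp (measurable_pi_apply a)).aemeasurable

/-- The vectors `U_m(k) = m^{-1/2} (k W₂(m) - m W₁(k)) / (m + k)` driving the monitoring
statistic. -/
noncomputable def drivingPath {Ω : Type*} {p : ℕ} (W₁ W₂ : ℝ≥0 → Ω → EuclideanSpace ℝ (Fin p))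
    (m k : ℕ) (ω : Ω) : EuclideanSpace ℝ (Fin p) :=
  (√(m : ℝ))⁻¹ • (((k : ℝ) / (m + k)) • W₂ m ω - ((m : ℝ) / (m + k)) • W₁ k ω)

/-- The time `t / (t + 1)` for `t = k / m`. -/
noncomputable def gridTime (m k : ℕ) : ℝ≥0 := ((k : ℝ≥0) / m) / ((k : ℝ≥0) / m + 1)

/-- The glued process is applied to the rescaled motions `B_i(m t) / √m` at `u = k/(m+k) ≤ 1`. There
`1 - u = m/(m+k)` and `m u/(1-u) = k`, so only `B₂(m)` and `B₁(k)` appear. -/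
lemma identDistrib_drivingPath_real {Ω Ω' : Type*} [MeasurableSpace Ω] [MeasurableSpace Ω']
    {P : Measure Ω} {P' : Measure Ω'} {B₁ B₂ : ℝ≥0 → Ω → ℝ} {B : ℝ≥0 → Ω' → ℝ}
    (h₁ : IsPreBrownianReal B₁ P) (h₂ : IsPreBrownianReal B₂ P) (h : IsPreBrownianReal B P')
    (hind : IndepFun (fun ω t => B₁ t ω) (fun ω t => B₂ t ω) P) {m : ℕ} (hm : m ≠ 0) :
    IdentDistrib (fun ω (k : ℕ) => (√(m : ℝ))⁻¹ * (((k : ℝ) / (m + k)) * B₂ m ω -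
      ((m : ℝ) / (m + k)) * B₁ k ω)) (fun ω k => B (gridTime m k) ω) P P' := by
  have hm' : (m : ℝ≥0) ≠ 0 := Nat.cast_ne_zero.2 hm
  have hg := isPreBrownianReal_glue (h₁.smul hm') (h₂.smul hm')
    (hind.comp (φ := fun f t => (√((m : ℝ≥0) : ℝ))⁻¹ * f (m * t))
      (ψ := fun f t => (√((m : ℝ≥0) : ℝ))⁻¹ * f (m * t))
      (measurable_pi_lambda _ fun i => (measurable_pi_apply _).const_mul _)
      (measurable_pi_lambda _ fun i => (measurable_pi_apply _).const_mul _))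
  convert IsPreBrownianReal.identDistrib_comp hg h (gridTime m) using 1
  funext ω k
  have hmk : (m : ℝ≥0) + k ≠ 0 := by positivity
  have e1 : gridTime m k = k / (m + k) := by
    unfold gridTime
    field_simp
    rw [add_comm]
  have hlt : gridTime m k ≤ 1 := by
    rw [e1]
    exact div_le_one_of_le₀ (by simp) (by simp)
  have e2 : 1 - gridTime m k = m / (m + k) := by
    rw [e1]
    refine tsub_eq_of_eq_add ?_
    field_simp
  have e3 : (m : ℝ≥0) * (gridTime m k / (1 - gridTime m k)) = k := by
    rw [e2, e1]
    field_simp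
  rw [min_eq_left hlt, max_eq_right hlt, e3, e2, e1, mul_one]
  push_cast
  ring

theorem identDistrib_drivingPath {Ω Ω' : Type*} [MeasurableSpace Ω] [MeasurableSpace Ω']
    {P : Measure Ω} {P' : Measure Ω'} [IsProbabilityMeasure P] [IsProbabilityMeasure P'] {p : ℕ}
    {W₁ W₂ : ℝ≥0 → Ω → EuclideanSpace ℝ (Fin p)} {W : ℝ≥0 → Ω' → EuclideanSpace ℝ (Fin p)}
    (h₁ : IsStdBrownian W₁ P) (h₂ : IsStdBrownian W₂ P) (h : IsStdBrownian W P')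
    (hind : IndepFun (fun ω t => W₁ t ω) (fun ω t => W₂ t ω) P) {m : ℕ} (hm : m ≠ 0) :
    IdentDistrib (fun ω k => drivingPath W₁ W₂ m k ω) (fun ω k => W (gridTime m k) ω) P P' := by
  have key := identDistrib_of_iIndepFun_prod (P := P) (P' := P')
    (f := fun a ω (k : ℕ) => W₁ k ω a) (g := fun a ω => W₂ m ω a)
    (h := fun a ω (k : ℕ) => W (gridTime m k) ω a)
    (φ := fun x k => (√(m : ℝ))⁻¹ * (((k : ℝ) / (m + k)) * x.2 - ((m : ℝ) / (m + k)) * x.1 k))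
    (fun a => aemeasurable_pi_lambda _ fun k => (h₁.brownian a).aemeasurable _)
    (fun a => (h₂.brownian a).aemeasurable _)
    (h₁.indep.comp (fun _ f (k : ℕ) => f k) fun _ =>
      measurable_pi_lambda _ fun k => measurable_pi_apply _)
    (h₂.indep.comp (fun _ f => f m) fun _ => measurable_pi_apply _)
    (h.indep.comp (fun _ f k => f (gridTime m k)) fun _ =>
      measurable_pi_lambda _ fun k => measurable_pi_apply _)
    (hind.comp (φ := fun (f : ℝ≥0 → EuclideanSpace ℝ (Fin p)) a (k : ℕ) => f k a)
      (ψ := fun (f : ℝ≥0 → EuclideanSpace ℝ (Fin p)) a => f m a) (by fun_prop) (by fun_prop))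
    (by fun_prop)
    (fun a => identDistrib_drivingPath_real (h₁.brownian a).toIsPreBrownianReal
      (h₂.brownian a).toIsPreBrownianReal (h.brownian a).toIsPreBrownianReal
      (hind.comp (φ := fun (f : ℝ≥0 → EuclideanSpace ℝ (Fin p)) t => f t a)
        (ψ := fun (f : ℝ≥0 → EuclideanSpace ℝ (Fin p)) t => f t a) (by fun_prop) (by fun_prop)) hm)
  convert key.comp (u := fun (x : Fin p → ℕ → ℝ) (k : ℕ) => WithLp.toLp 2 fun a => x a k) ?_ using 1
  · funext ω k
    ext a
    simp [drivingPath]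
  · rfl
  · fun_prop

/-! ### Convergence of grid maxima along a continuous path -/

/-- A weight function that is continuous and positive on `[tw, Tw]` and vanishes elsewhere. -/
def IsCutoffWeight (w : ℝ≥0 → ℝ) : Prop :=
  ∃ (w' : ℝ≥0 → ℝ) (tw : ℝ≥0) (Tw : ℝ≥0∞), (tw : ℝ≥0∞) ≠ Tw ∧ Continuous w' ∧ (∀ t, 0 < w' t) ∧
    ∀ t, w t = Set.indicator {t : ℝ≥0 | tw ≤ t ∧ (t : ℝ≥0∞) ≤ Tw} w' t

lemma IsWeightFunction.isCutoffWeight {w : ℝ≥0 → ℝ} (h : IsWeightFunction w) :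
    IsCutoffWeight w := by
  obtain ⟨w', tw, Tw, -, h1, h2, h3, h4, -⟩ := h
  exact ⟨w', tw, Tw, h1, h2, h3, h4⟩

lemma isCutoffWeight_of_continuous {w : ℝ≥0 → ℝ} (hc : Continuous w) (hpos : ∀ t, 0 < w t) :
    IsCutoffWeight w :=
  ⟨w, 0, ∞, by simp, hc, hpos, fun t => by simp⟩

lemma IsCutoffWeight.nonneg {w : ℝ≥0 → ℝ} (h : IsCutoffWeight w) (t : ℝ≥0) : 0 ≤ w t := by
  obtain ⟨w', tw, Tw, -, -, hpos, hw⟩ := h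
  rw [hw]
  exact Set.indicator_nonneg (fun t _ => (hpos t).le) t

lemma IsCutoffWeight.exists_le {w : ℝ≥0 → ℝ} (h : IsCutoffWeight w) (T : ℝ≥0) :
    ∃ C, 0 ≤ C ∧ ∀ t ≤ T, w t ≤ C := by
  obtain ⟨w', tw, Tw, -, hc, hpos, hw⟩ := h
  obtain ⟨C, hC⟩ := (isCompact_Icc (a := (0 : ℝ≥0)) (b := T)).bddAbove_image hc.continuousOn
  refine ⟨C, (hpos 0).le.trans (hC ⟨0, by simp, rfl⟩), fun t ht => ?_⟩
  rw [hw]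
  exact (Set.indicator_le_self' (fun t _ => (hpos t).le) t).trans (hC ⟨t, by simpa using ht, rfl⟩)

/-- The weight jumps at the ends of its window, so grid points near `t` must stay inside. At `t = T`
the grid is hit exactly; at `t = Tw` one rounds down, which stays above `tw` because `tw ≠ Tw`;
otherwise one rounds up. The last bound keeps `⌊s m⌋₊` at or below `k m` for `s ≤ t`. -/
lemma exists_grid_approx {tw : ℝ≥0} {Tw : ℝ≥0∞} (hne : (tw : ℝ≥0∞) ≠ Tw) {T : ℕ} {t : ℝ≥0}
    (h1 : tw ≤ t) (h2 : (t : ℝ≥0∞) ≤ Tw) (h3 : t ≤ T) :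
    ∃ k : ℕ → ℕ, Tendsto (fun m => (k m : ℝ≥0) / m) atTop (𝓝 t) ∧
      ∀ᶠ m in atTop, k m ≤ T * m ∧ tw ≤ (k m : ℝ≥0) / m ∧ (((k m : ℝ≥0) / m : ℝ≥0) : ℝ≥0∞) ≤ Tw ∧
        ⌊(t : ℝ) * m⌋₊ ≤ k m := by
  have hpos : ∀ᶠ m : ℕ in atTop, 0 < m := eventually_gt_atTop 0
  rcases h3.eq_or_lt with rfl | h3'
  · have he : ∀ᶠ m : ℕ in atTop, (((T * m : ℕ) : ℝ≥0) / m) = T := by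
      filter_upwards [hpos] with m hm
      have : (m : ℝ≥0) ≠ 0 := Nat.cast_ne_zero.2 hm.ne'
      push_cast
      field_simp
    refine ⟨fun m => T * m, tendsto_const_nhds.congr' (he.mono fun m hm => hm.symm), ?_⟩
    filter_upwards [he] with m hm
    rw [hm]
    refine ⟨le_rfl, h1, h2, ?_⟩
    have : (((T : ℝ≥0) : ℝ) * m) = ((T * m : ℕ) : ℝ) := by push_cast; ring
    rw [this, Nat.floor_natCast]
  have hle {k : ℕ → ℕ} (m : ℕ) (hm : 0 < m) (hk : (k m : ℝ≥0) / m ≤ T) : k m ≤ T * m := by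
    have hm' : (0 : ℝ≥0) < m := Nat.cast_pos.2 hm
    rw [div_le_iff₀ hm'] at hk
    exact_mod_cast hk
  rcases h2.eq_or_lt with h2' | h2'
  · have ht : Tendsto (fun m : ℕ => ((⌊(t : ℝ) * m⌋₊ : ℕ) : ℝ≥0) / m) atTop (𝓝 t) := by
      rw [← NNReal.tendsto_coe]
      push_cast
      exact (tendsto_nat_floor_mul_div_atTop t.2).comp tendsto_natCast_atTop_atTop
    have htw : tw < t := lt_of_le_of_ne h1 fun h => hne (by rw [h, h2'])
    refine ⟨_, ht, ?_⟩
    filter_upwards [hpos, ht.eventually_const_lt htw] with m hm hlt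
    have hfl : ((⌊(t : ℝ) * m⌋₊ : ℕ) : ℝ≥0) / m ≤ t := by
      rw [div_le_iff₀ (Nat.cast_pos.2 hm), ← NNReal.coe_le_coe]
      push_cast
      exact Nat.floor_le (by positivity)
    exact ⟨hle (k := fun m => ⌊(t : ℝ) * m⌋₊) m hm (hfl.trans h3), hlt.le,
      (ENNReal.coe_le_coe.2 hfl).trans h2, le_rfl⟩
  · have ht : Tendsto (fun m : ℕ => ((⌈(t : ℝ) * m⌉₊ : ℕ) : ℝ≥0) / m) atTop (𝓝 t) := by
      rw [← NNReal.tendsto_coe]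
      push_cast
      exact (tendsto_nat_ceil_mul_div_atTop t.2).comp tendsto_natCast_atTop_atTop
    refine ⟨_, ht, ?_⟩
    have ht' := (ENNReal.continuous_coe.tendsto t).comp ht
    filter_upwards [hpos, ht.eventually_lt_const h3', ht'.eventually_lt_const h2']
      with m hm hlt hlt'
    have hfl : t ≤ ((⌈(t : ℝ) * m⌉₊ : ℕ) : ℝ≥0) / m := by
      rw [le_div_iff₀ (Nat.cast_pos.2 hm), ← NNReal.coe_le_coe]
      push_cast
      exact Nat.le_ceil _
    exact ⟨hle (k := fun m => ⌈(t : ℝ) * m⌉₊) m hm hlt.le, h1.trans hfl, hlt'.le,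
      Nat.floor_le_ceil _⟩

lemma bddAbove_of_continuous {p : ℕ} {f : ℝ≥0 → EuclideanSpace ℝ (Fin p)} (hf : Continuous f)
    (T : ℝ≥0) : ∃ D, 0 ≤ D ∧ ∀ t ≤ T, ‖f t‖ ≤ D := by
  obtain ⟨D, hD⟩ := (isCompact_Icc (a := (0 : ℝ≥0)) (b := T)).bddAbove_image hf.norm.continuousOn
  exact ⟨D, (norm_nonneg (f 0)).trans (hD ⟨0, by simp, rfl⟩),
    fun t ht => hD ⟨t, by simpa using ht, rfl⟩⟩

lemma continuous_div_add_one : Continuous fun t : ℝ≥0 => t / (t + 1) :=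
  continuous_id.div₀ (by fun_prop) fun t => by positivity

section ClosedEndLimit

variable {Ω : Type*} {p : ℕ} {W : ℝ≥0 → Ω → EuclideanSpace ℝ (Fin p)} {w : ℝ≥0 → ℝ} {T : ℕ} {ω : Ω}

lemma closedEndLimit_nonneg (hw : IsCutoffWeight w) : 0 ≤ closedEndLimit W w T ω :=
  Real.iSup_nonneg fun t => Real.iSup_nonneg fun s =>
    mul_nonneg (mul_nonneg (by positivity) (hw.nonneg _)) (norm_nonneg _)

/-- A real supremum bounds its members only if the family is bounded, which holds here because the
path is continuous on a compact time interval. -/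
lemma le_closedEndLimit (hw : IsCutoffWeight w) (hc : Continuous fun t => W t ω) {s t : ℝ≥0}
    (hst : s ≤ t) (ht : t ≤ T) :
    ((t : ℝ) + 1) * w t * ‖W (t / (t + 1)) ω - W (s / (s + 1)) ω‖ ≤ closedEndLimit W w T ω := by
  obtain ⟨C, hC0, hC⟩ := hw.exists_le T
  obtain ⟨D, hD0, hD⟩ := bddAbove_of_continuous (hc.comp continuous_div_add_one) T
  have hb (t s : ℝ≥0) (ht : t ≤ T) (hs : s ≤ T) :
      ((t : ℝ) + 1) * w t * ‖W (t / (t + 1)) ω - W (s / (s + 1)) ω‖ ≤ (T + 1) * C * (D + D) := by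
    have ht' : (t : ℝ) ≤ T := by exact_mod_cast ht
    have hwt := hw.nonneg t
    gcongr
    · exact hC t ht
    · exact (norm_sub_le _ _).trans (add_le_add (hD t ht) (hD s hs))
  have hbs (t : Set.Icc (0 : ℝ≥0) T) : BddAbove (Set.range fun s : Set.Icc (0 : ℝ≥0) (t : ℝ≥0) =>
      (((t : ℝ≥0) : ℝ) + 1) * w t *
        ‖W ((t : ℝ≥0) / (t + 1)) ω - W ((s : ℝ≥0) / (s + 1)) ω‖) :=
    ⟨_, Set.forall_mem_range.2 fun s => hb t s t.2.2 (s.2.2.trans t.2.2)⟩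
  refine le_ciSup_of_le ⟨(T + 1) * C * (D + D), Set.forall_mem_range.2 fun t => ?_⟩
    (⟨t, by simp, ht⟩ : Set.Icc (0 : ℝ≥0) T) (le_ciSup_of_le (hbs _) ⟨s, by simp, hst⟩ le_rfl)
  exact Real.iSup_le (fun s => hb t s t.2.2 (s.2.2.trans t.2.2)) (by positivity)

lemma closedEndLimit_le {a : ℝ} (ha : 0 ≤ a)
    (h : ∀ t s : ℝ≥0, s ≤ t → t ≤ T →
      ((t : ℝ) + 1) * w t * ‖W (t / (t + 1)) ω - W (s / (s + 1)) ω‖ ≤ a) :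
    closedEndLimit W w T ω ≤ a :=
  Real.iSup_le (fun t => Real.iSup_le (fun s => h t s s.2.2 t.2.2) ha) ha

/-- The weighted maximum over the grid of mesh `1 / m` of the increments of `U`, where `U k` is
the value at time `k / m`. -/
noncomputable def gridFunctional (w : ℝ≥0 → ℝ) (T m : ℕ) (U : ℕ → EuclideanSpace ℝ (Fin p)) : ℝ :=
  gridMax (T * m) (fun k => w ((k : ℝ≥0) / m)) fun k j => ((k : ℝ) / m + 1) * ‖U k - U j‖

lemma gridFunctional_zero (U : ℕ → EuclideanSpace ℝ (Fin p)) : gridFunctional w T 0 U = 0 := by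
  rw [gridFunctional, gridMax, mul_zero]
  have : IsEmpty (Finset.Icc 1 0) := ⟨fun k => by simpa using k.2⟩
  exact Real.iSup_of_isEmpty _

lemma gridFunctional_nonneg (hw : IsCutoffWeight w) (m : ℕ) (U : ℕ → EuclideanSpace ℝ (Fin p)) :
    0 ≤ gridFunctional w T m U :=
  gridMax_nonneg (fun _ => hw.nonneg _) fun k j => by positivity

lemma aemeasurable_gridFunctional (m : ℕ) (μ : Measure (ℕ → EuclideanSpace ℝ (Fin p))) :
    AEMeasurable (gridFunctional w T m) μ :=
  aemeasurable_gridMax _ fun k j _ _ _ => Measurable.aemeasurable (by fun_prop)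

lemma gridFunctional_le_closedEndLimit (hw : IsCutoffWeight w) (hc : Continuous fun t => W t ω)
    (m : ℕ) : gridFunctional w T m (fun k => W (gridTime m k) ω) ≤ closedEndLimit W w T ω := by
  refine gridMax_le (fun _ => hw.nonneg _) (closedEndLimit_nonneg hw) fun k j hk hkT hj => ?_
  have hm : 0 < m := Nat.pos_of_ne_zero fun h => by subst h; omega
  have hm' : (0 : ℝ≥0) < m := Nat.cast_pos.2 hm
  have h1 : (j : ℝ≥0) / m ≤ k / m := by gcongr
  have h2 : (k : ℝ≥0) / m ≤ T := by
    rw [div_le_iff₀ hm']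
    exact_mod_cast hkT
  refine le_trans (le_of_eq ?_) (le_closedEndLimit hw hc h1 h2)
  push_cast
  simp only [gridTime]
  ring

/-- The grid maximum never exceeds the continuum supremum. For the lower bound, a nearly optimal
pair `(t, s)` is approximated by grid points. -/
lemma tendsto_gridFunctional (hw : IsCutoffWeight w) (hc : Continuous fun t => W t ω) :
    Tendsto (fun m => gridFunctional w T m (fun k => W (gridTime m k) ω)) atTop
      (𝓝 (closedEndLimit W w T ω)) := by
  refine tendsto_order.2 ⟨fun a ha => ?_, fun a ha => Eventually.of_forall fun m =>
    (gridFunctional_le_closedEndLimit hw hc m).trans_lt ha⟩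
  rcases lt_or_ge a 0 with ha0 | ha0
  · exact Eventually.of_forall fun m => ha0.trans_le (gridFunctional_nonneg hw m _)
  have hex : ∃ t s : ℝ≥0, s ≤ t ∧ t ≤ T ∧
      a < ((t : ℝ) + 1) * w t * ‖W (t / (t + 1)) ω - W (s / (s + 1)) ω‖ := by
    by_contra! h
    exact absurd (closedEndLimit_le ha0 h) (not_le.2 ha)
  obtain ⟨t, s, hst, htT, hlt⟩ := hex
  obtain ⟨w', tw, Tw, hne, hcw, hpos, hw'⟩ := id hw
  -- A value above `a ≥ 0` forces a nonzero weight, hence `t` in the window.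
  have htJ : t ∈ {t : ℝ≥0 | tw ≤ t ∧ (t : ℝ≥0∞) ≤ Tw} := by
    by_contra h
    rw [hw', Set.indicator_of_notMem h] at hlt
    simp only [mul_zero, zero_mul] at hlt
    exact absurd hlt (not_lt.2 ha0)
  rw [hw', Set.indicator_of_mem htJ] at hlt
  obtain ⟨k, hk, hkev⟩ := exists_grid_approx hne htJ.1 htJ.2 htT
  have hj : Tendsto (fun m : ℕ => ((⌊(s : ℝ) * m⌋₊ : ℕ) : ℝ≥0) / m) atTop (𝓝 s) := by
    rw [← NNReal.tendsto_coe]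
    push_cast
    exact (tendsto_nat_floor_mul_div_atTop s.2).comp tendsto_natCast_atTop_atTop
  set g : ℝ≥0 → EuclideanSpace ℝ (Fin p) := fun t => W (t / (t + 1)) ω with hg
  have hgc : Continuous g := hc.comp continuous_div_add_one
  -- The continuous `w'` stands in for `w`; the two agree at the chosen grid points, which lie in
  -- the window.
  have hlim : Tendsto (fun m : ℕ => ((((k m : ℝ≥0) / m : ℝ≥0) : ℝ) + 1) * w' ((k m : ℝ≥0) / m) *
      ‖g ((k m : ℝ≥0) / m) - g (((⌊(s : ℝ) * m⌋₊ : ℕ) : ℝ≥0) / m)‖) atTop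
      (𝓝 (((t : ℝ) + 1) * w' t * ‖g t - g s‖)) :=
    (((NNReal.tendsto_coe.2 hk).add_const 1).mul ((hcw.tendsto t).comp hk)).mul
      (((hgc.tendsto t).comp hk).sub ((hgc.tendsto s).comp hj)).norm
  filter_upwards [hlim.eventually_const_lt hlt, hkev] with m hm ⟨hkT, hk1, hk2, hfl⟩
  have hjk : ⌊(s : ℝ) * m⌋₊ ≤ k m :=
    (Nat.floor_le_floor (mul_le_mul_of_nonneg_right (NNReal.coe_le_coe.2 hst)
      (Nat.cast_nonneg m))).trans hfl
  -- Equal indices would give a zero increment, which cannot exceed `a ≥ 0`.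
  have hjk' : ⌊(s : ℝ) * m⌋₊ < k m := by
    refine lt_of_le_of_ne hjk fun h => ?_
    rw [h, sub_self, norm_zero, mul_zero] at hm
    exact absurd hm (not_lt.2 ha0)
  refine hm.trans_le (le_trans (le_of_eq ?_)
    (le_gridMax (fun _ => hw.nonneg _) (by omega) hkT hjk'))
  simp only []
  rw [hw', Set.indicator_of_mem (show _ ∈ {t : ℝ≥0 | tw ≤ t ∧ (t : ℝ≥0∞) ≤ Tw} from ⟨hk1, hk2⟩)]
  push_cast
  simp only [hg, gridTime]
  ring

end ClosedEndLimit

/-! ### The limit in distribution for the Brownian approximation -/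

section Distribution

variable {Ω Ω' : Type*} [MeasurableSpace Ω] [MeasurableSpace Ω'] {P : Measure Ω} {P' : Measure Ω'}
  {p : ℕ}

lemma IsStdBrownian.ae_continuous {W : ℝ≥0 → Ω → EuclideanSpace ℝ (Fin p)}
    (h : IsStdBrownian W P) : ∀ᵐ ω ∂P, Continuous fun t => W t ω := by
  filter_upwards [ae_all_iff.2 fun a => (h.brownian a).cont] with ω hω
  exact (PiLp.continuous_toLp 2 _).comp (continuous_pi hω)

lemma IsStdBrownian.aemeasurable {W : ℝ≥0 → Ω → EuclideanSpace ℝ (Fin p)}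
    (h : IsStdBrownian W P) (t : ℝ≥0) : AEMeasurable (W t) P :=
  (WithLp.measurable_toLp 2 _).comp_aemeasurable
    (aemeasurable_pi_lambda _ fun a => (h.brownian a).aemeasurable t)

lemma aemeasurable_gridFunctional_brownian {W : ℝ≥0 → Ω → EuclideanSpace ℝ (Fin p)}
    (h : IsStdBrownian W P) (w : ℝ≥0 → ℝ) (T m : ℕ) :
    AEMeasurable (fun ω => gridFunctional w T m (fun k => W (gridTime m k) ω)) P :=
  (aemeasurable_gridFunctional m _).comp_aemeasurable
    (aemeasurable_pi_lambda _ fun _ => h.aemeasurable _)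

/-- The supremum is over uncountably many times; it is measurable as an almost sure limit of finite
grid maxima. -/
lemma aemeasurable_closedEndLimit {W : ℝ≥0 → Ω → EuclideanSpace ℝ (Fin p)}
    (h : IsStdBrownian W P) {w : ℝ≥0 → ℝ} (hw : IsCutoffWeight w) (T : ℕ) :
    AEMeasurable (closedEndLimit W w T) P :=
  aemeasurable_of_tendsto_metrizable_ae atTop
    (fun m => aemeasurable_gridFunctional_brownian h w T m)
    (h.ae_continuous.mono fun _ hω => tendsto_gridFunctional hw hω)

variable [IsProbabilityMeasure P] [IsProbabilityMeasure P']

lemma identDistrib_gridFunctional {W₁ W₂ : ℝ≥0 → Ω → EuclideanSpace ℝ (Fin p)}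
    {W : ℝ≥0 → Ω' → EuclideanSpace ℝ (Fin p)}
    (h₁ : IsStdBrownian W₁ P) (h₂ : IsStdBrownian W₂ P) (h : IsStdBrownian W P')
    (hind : IndepFun (fun ω t => W₁ t ω) (fun ω t => W₂ t ω) P) (w : ℝ≥0 → ℝ) (T m : ℕ) :
    IdentDistrib (fun ω => gridFunctional w T m (fun k => drivingPath W₁ W₂ m k ω))
      (fun ω => gridFunctional w T m (fun k => W (gridTime m k) ω)) P P' := by
  rcases eq_or_ne m 0 with rfl | hm
  · simp only [gridFunctional_zero]
    exact ⟨aemeasurable_const, aemeasurable_const, by simp⟩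
  · exact (identDistrib_drivingPath h₁ h₂ h hind hm).comp_of_aemeasurable
      (aemeasurable_gridFunctional m _)

/-- For each `m` the variable has the law of a grid maximum of the one motion `W`, and these
converge almost surely. -/
theorem tendstoInDistribution_gridFunctional {W₁ W₂ : ℕ → ℝ≥0 → Ω → EuclideanSpace ℝ (Fin p)}
    {W : ℝ≥0 → Ω' → EuclideanSpace ℝ (Fin p)}
    (h₁ : ∀ m, IsStdBrownian (W₁ m) P) (h₂ : ∀ m, IsStdBrownian (W₂ m) P)
    (h : IsStdBrownian W P')
    (hind : ∀ m, IndepFun (fun ω t => W₁ m t ω) (fun ω t => W₂ m t ω) P)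
    {w : ℝ≥0 → ℝ} (hw : IsCutoffWeight w) (T : ℕ) :
    TendstoInDistribution
      (fun m ω => gridFunctional w T m (fun k => drivingPath (W₁ m) (W₂ m) m k ω)) atTop
      (closedEndLimit W w T) (fun _ => P) P' := by
  have hid m := identDistrib_gridFunctional (h₁ m) (h₂ m) h (hind m) w T m
  have hlim := tendstoInDistribution_of_ae_tendsto
    (fun m => aemeasurable_gridFunctional_brownian h w T m) (aemeasurable_closedEndLimit h hw T)
    (h.ae_continuous.mono fun _ hω => tendsto_gridFunctional hw hω)
  refine ⟨fun m => (hid m).aemeasurable_fst, hlim.aemeasurable_limit,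
    hlim.tendsto.congr fun m => ?_⟩
  exact Subtype.ext (hid m).map_eq.symm

/-- Tightness uniform in `m`: in law, every grid maximum is dominated by the single finite variable
`closedEndLimit W w T`. -/
lemma exists_forall_measure_gridFunctional_gt_le
    {W₁ W₂ : ℕ → ℝ≥0 → Ω → EuclideanSpace ℝ (Fin p)} {W : ℝ≥0 → Ω' → EuclideanSpace ℝ (Fin p)}
    (h₁ : ∀ m, IsStdBrownian (W₁ m) P) (h₂ : ∀ m, IsStdBrownian (W₂ m) P)
    (h : IsStdBrownian W P')
    (hind : ∀ m, IndepFun (fun ω t => W₁ m t ω) (fun ω t => W₂ m t ω) P)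
    {w : ℝ≥0 → ℝ} (hw : IsCutoffWeight w) (T : ℕ) {δ : ℝ≥0∞} (hδ : 0 < δ) :
    ∃ K : ℝ, 0 ≤ K ∧ ∀ m,
      P {ω | K < gridFunctional w T m (fun k => drivingPath (W₁ m) (W₂ m) m k ω)} ≤ δ := by
  have hL := aemeasurable_closedEndLimit h hw T
  have h0 : Tendsto (fun n : ℕ => P' {ω | (n : ℝ) < closedEndLimit W w T ω}) atTop (𝓝 0) := by
    have hemp : ⋂ n : ℕ, {ω | (n : ℝ) < closedEndLimit W w T ω} = ∅ := by
      ext ω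
      simp only [Set.mem_iInter, Set.mem_ofPred_eq, Set.mem_empty_iff_false, iff_false, not_forall,
        not_lt]
      exact exists_nat_ge _
    rw [← measure_empty (μ := P'), ← hemp]
    refine tendsto_measure_iInter_atTop (fun n => nullMeasurableSet_lt aemeasurable_const hL)
      (fun a b hab ω hω => ?_) ⟨0, measure_ne_top _ _⟩
    exact lt_of_le_of_lt (Nat.cast_le.2 hab) (Set.mem_ofPred_eq ▸ hω)
  obtain ⟨n, hn⟩ := (h0.eventually_le_const hδ).exists
  refine ⟨n, Nat.cast_nonneg n, fun m => ?_⟩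
  have hid := identDistrib_gridFunctional (h₁ m) (h₂ m) h (hind m) w T m
  refine (hid.measure_mem_eq (measurableSet_Ioi (a := (n : ℝ)))).trans_le
    ((measure_mono_ae ?_).trans hn)
  filter_upwards [h.ae_continuous] with ω hω hlt
  exact lt_of_lt_of_le hlt (gridFunctional_le_closedEndLimit hw hω m)

end Distribution

/-! ### Comparison of the statistic with its Brownian approximation -/

lemma sum_Icc_add_sum_Icc {E : Type*} [AddCommMonoid E] (f : ℤ → E) {a b c : ℤ} (hab : a ≤ b + 1)
    (hbc : b ≤ c) :
    ∑ t ∈ Finset.Icc a b, f t + ∑ t ∈ Finset.Icc (b + 1) c, f t = ∑ t ∈ Finset.Icc a c, f t := by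
  rw [← Finset.sum_union]
  · congr 1
    ext x
    simp only [Finset.mem_union, Finset.mem_Icc]
    omega
  · rw [Finset.disjoint_left]
    intro x
    simp only [Finset.mem_Icc]
    omega

section Deterministic

variable {p : ℕ}

/-- The second estimator averages exactly `k - j` terms, and `(k - j)/(m + j) + 1 = (m + k)/(m +
j)`. -/
lemma smul_estimator_sub_eq {E : Type*} [AddCommGroup E] [Module ℝ E] {Z : ℤ → E}
    {est R : ℤ → ℤ → E} {θ₀ : E}
    (hest : ∀ i j, est i j = θ₀ + ((j - i + 1 : ℤ) : ℝ)⁻¹ • ∑ t ∈ Finset.Icc i j, Z t + R i j)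
    {m j k : ℕ} (hm : 0 < m) (hj : j < k) :
    ((k : ℝ) - j) • (est 1 (m + j) - est (m + j + 1) (m + k)) =
      (((m : ℝ) + k) / (m + j)) •
          (∑ t ∈ Finset.Icc (1 : ℤ) m, Z t + ∑ t ∈ Finset.Icc ((m : ℤ) + 1) (m + j), Z t) -
        (∑ t ∈ Finset.Icc (1 : ℤ) m, Z t + ∑ t ∈ Finset.Icc ((m : ℤ) + 1) (m + k), Z t) +
        ((k : ℝ) - j) • (R 1 (m + j) - R (m + j + 1) (m + k)) := by
  have e1 := sum_Icc_add_sum_Icc Z (a := 1) (b := m) (c := m + j) (by omega) (by omega)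
  have e2 := sum_Icc_add_sum_Icc Z (a := m + 1) (b := m + j) (c := m + k) (by omega) (by omega)
  rw [hest, hest, ← e1, ← e2]
  have hmj : (m : ℝ) + j ≠ 0 := by positivity
  have hkj : (k : ℝ) - j ≠ 0 := by
    rw [sub_ne_zero]
    exact_mod_cast hj.ne'
  have c1 : ((((m : ℤ) + j - 1 + 1 : ℤ)) : ℝ) = m + j := by push_cast; ring
  have c2 : ((((m : ℤ) + k - (m + j + 1) + 1 : ℤ)) : ℝ) = k - j := by push_cast; ring
  rw [c1, c2]
  match_scalars <;> field_simp <;> ring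

/-- The constants come from `(m + k)/(m + j) ≤ T + 1` and `k - j ≤ T (m + j)`: the sums cost `(T +
1) 2a + 2a`, the remainders `T ρ + ρ`. -/
lemma norm_smul_estimator_sub_le {E : Type*} [NormedAddCommGroup E] [NormedSpace ℝ E]
    {Z : ℤ → E} {est R : ℤ → ℤ → E} {θ₀ : E}
    (hest : ∀ i j, est i j = θ₀ + ((j - i + 1 : ℤ) : ℝ)⁻¹ • ∑ t ∈ Finset.Icc i j, Z t + R i j)
    {b₁ : ℕ → E} {b₂ : E} {T m : ℕ} (hm : 0 < m) {a ρ : ℝ}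
    (h₂ : ‖∑ t ∈ Finset.Icc (1 : ℤ) m, Z t - b₂‖ ≤ a)
    (h₁ : ∀ k ≤ T * m, ‖∑ t ∈ Finset.Icc ((m : ℤ) + 1) (m + k), Z t - b₁ k‖ ≤ a)
    (hR : ∀ i j : ℤ, 1 ≤ i → i ≤ j → j ≤ (T + 1) * m → ((j - i + 1 : ℤ) : ℝ) * ‖R i j‖ ≤ ρ)
    {j k : ℕ} (hj : j < k) (hk : k ≤ T * m) :
    ‖((k : ℝ) - j) • (est 1 (m + j) - est (m + j + 1) (m + k)) -
      ((((m : ℝ) + k) / (m + j)) • (b₂ + b₁ j) - (b₂ + b₁ k))‖ ≤ 2 * (T + 2) * a + (T + 1) * ρ := by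
  rw [smul_estimator_sub_eq hest hm hj]
  set S₀ := ∑ t ∈ Finset.Icc (1 : ℤ) m, Z t
  set Sj := ∑ t ∈ Finset.Icc ((m : ℤ) + 1) (m + j), Z t
  set Sk := ∑ t ∈ Finset.Icc ((m : ℤ) + 1) (m + k), Z t
  have hmk : ((m + k : ℕ) : ℤ) ≤ (T + 1) * m := by
    have : m + k ≤ (T + 1) * m := by rw [add_mul, one_mul]; omega
    exact_mod_cast this
  have hm' : (0 : ℝ) < m := Nat.cast_pos.2 hm
  have hk' : (k : ℝ) ≤ T * m := by exact_mod_cast hk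
  have hj' : (j : ℝ) < k := by exact_mod_cast hj
  have hj0 : (0 : ℝ) ≤ j := Nat.cast_nonneg j
  have hr₁ := hR 1 (m + j) le_rfl (by omega) (by push_cast at hmk; omega)
  have hr₂ := hR (m + j + 1) (m + k) (by omega) (by omega) (by push_cast at hmk; omega)
  have c1 : ((((m : ℤ) + j - 1 + 1 : ℤ)) : ℝ) = m + j := by push_cast; ring
  have c2 : ((((m : ℤ) + k - (m + j + 1) + 1 : ℤ)) : ℝ) = k - j := by push_cast; ring
  rw [c1] at hr₁
  rw [c2] at hr₂
  have ha : 0 ≤ a := (norm_nonneg _).trans h₂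
  have hT : (0 : ℝ) ≤ T := Nat.cast_nonneg T
  have hq : ((m : ℝ) + k) / (m + j) ≤ T + 1 := by
    rw [div_le_iff₀ (by positivity)]
    nlinarith
  have hq0 : 0 ≤ ((m : ℝ) + k) / (m + j) := by positivity
  have n1 : ‖(S₀ - b₂) + (Sj - b₁ j)‖ ≤ a + a :=
    (norm_add_le _ _).trans (add_le_add h₂ (h₁ j (hj.le.trans hk)))
  have n2 : ‖(S₀ - b₂) + (Sk - b₁ k)‖ ≤ a + a :=
    (norm_add_le _ _).trans (add_le_add h₂ (h₁ k hk))
  have n3 : ‖((k : ℝ) - j) • R 1 (m + j)‖ ≤ T * ρ := by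
    rw [norm_smul, Real.norm_of_nonneg (by linarith)]
    calc ((k : ℝ) - j) * ‖R 1 (m + j)‖ ≤ (T * (m + j)) * ‖R 1 (m + j)‖ := by
          gcongr
          nlinarith
      _ = T * ((m + j) * ‖R 1 (m + j)‖) := by ring
      _ ≤ T * ρ := by gcongr
  have n4 : ‖((k : ℝ) - j) • R (m + j + 1) (m + k)‖ ≤ ρ := by
    rwa [norm_smul, Real.norm_of_nonneg (by linarith)]
  have n5 : ‖(((m : ℝ) + k) / (m + j)) • ((S₀ - b₂) + (Sj - b₁ j))‖ ≤ (T + 1) * (a + a) := by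
    rw [norm_smul, Real.norm_of_nonneg hq0]
    exact mul_le_mul hq n1 (norm_nonneg _) (by positivity)
  calc _ = ‖((((m : ℝ) + k) / (m + j)) • ((S₀ - b₂) + (Sj - b₁ j)) - ((S₀ - b₂) + (Sk - b₁ k))) +
        (((k : ℝ) - j) • R 1 (m + j) - ((k : ℝ) - j) • R (m + j + 1) (m + k))‖ := by
        congr 1
        module
    _ ≤ ((T + 1) * (a + a) + (a + a)) + (T * ρ + ρ) :=
        (norm_add_le _ _).trans (add_le_add ((norm_sub_le _ _).trans (add_le_add n5 n2))
          ((norm_sub_le _ _).trans (add_le_add n3 n4)))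
    _ = _ := by ring

lemma smul_drivingPath_sub {Ω : Type*} (W₁ W₂ : ℝ≥0 → Ω → EuclideanSpace ℝ (Fin p)) {m : ℕ}
    (hm : 0 < m) (j k : ℕ) (ω : Ω) :
    ((k : ℝ) / m + 1) • (drivingPath W₁ W₂ m k ω - drivingPath W₁ W₂ m j ω) =
      (√(m : ℝ))⁻¹ • ((((m : ℝ) + k) / (m + j)) • (W₂ m ω + W₁ j ω) - (W₂ m ω + W₁ k ω)) := by
  have hm' : (m : ℝ) ≠ 0 := Nat.cast_ne_zero.2 hm.ne'
  have hmj : (m : ℝ) + j ≠ 0 := by positivity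
  have hmk : (m : ℝ) + k ≠ 0 := by positivity
  have hs : √(m : ℝ) ≠ 0 := by positivity
  unfold drivingPath
  match_scalars <;> field_simp <;> ring

lemma closedEndStatistic_eq_gridMax {Ω : Type*} {d : ℕ}
    (θ : ((Fin d → ℝ) → ℝ) → EuclideanSpace ℝ (Fin p))
    (X : ℤ → Ω → Fin d → ℝ) (Shat : ℕ → Ω → Matrix (Fin p) (Fin p) ℝ) (w : ℝ≥0 → ℝ)
    (T m : ℕ) (ω : Ω) :
    closedEndStatistic θ X Shat w T m ω = gridMax (T * m) (fun k => w ((k : ℝ≥0) / m)) fun k j =>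
      weightedNorm (Shat m ω)⁻¹ ((√(m : ℝ))⁻¹ • (((k : ℝ) - j) •
        (estimator θ X 1 (m + j) ω - estimator θ X (m + j + 1) (m + k) ω))) := by
  unfold closedEndStatistic gridMax detector
  refine iSup_congr fun k => ?_
  rw [Real.mul_iSup_of_nonneg (by positivity)]
  congr 1
  refine iSup_congr fun j => ?_
  have hjk : ((j : ℕ) : ℝ) ≤ (k : ℕ) := by exact_mod_cast j.2.le
  beta_reduce
  rw [weightedNorm_smul _ (by positivity), weightedNorm_smul _ (sub_nonneg.2 hjk)]

/-- Replacing `M⁻¹` by `S⁻¹` and replacing `x` by `√S y` each cost at most `ε² / 2` under the square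
root; `δ ≤ 1` gives `‖x‖ ≤ K + 1`. -/
lemma abs_weightedNorm_sub_norm_le {S M : Matrix (Fin p) (Fin p) ℝ} (hS : 0 ≤ S)
    (hdet : S.det ≠ 0) {x y : EuclideanSpace ℝ (Fin p)} {K r δ ε : ℝ} (hδ1 : δ ≤ 1)
    (hy : ‖sqrtMulVec S y‖ ≤ K) (hxy : ‖x - sqrtMulVec S y‖ ≤ δ)
    (hM : ‖Matrix.toEuclideanCLM (𝕜 := ℝ) (M⁻¹ - S⁻¹)‖ ≤ r) (hε : 0 ≤ ε)
    (hr : r * (K + 1) ^ 2 ≤ ε ^ 2 / 2)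
    (hδ : ‖Matrix.toEuclideanCLM (𝕜 := ℝ) S⁻¹‖ * δ * (2 * K + 1) ≤ ε ^ 2 / 2) :
    |weightedNorm M⁻¹ x - ‖y‖| ≤ ε := by
  rw [← weightedNorm_inv_sqrtMulVec hS hdet y]
  refine (abs_weightedNorm_sub_le _ _ _ _).trans (Real.sqrt_le_iff.2 ⟨hε, ?_⟩)
  have hx : ‖x‖ ≤ K + 1 := by
    have := norm_add_le (x - sqrtMulVec S y) (sqrtMulVec S y)
    rw [sub_add_cancel] at this
    linarith
  have hδ0 : 0 ≤ δ := (norm_nonneg _).trans hxy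
  have hr0 : 0 ≤ r := (norm_nonneg _).trans hM
  calc _ ≤ r * (K + 1) ^ 2 + ‖Matrix.toEuclideanCLM (𝕜 := ℝ) S⁻¹‖ * δ * ((K + 1) + K) := by
        gcongr
    _ ≤ ε ^ 2 := by
        rw [show K + 1 + K = 2 * K + 1 by ring]
        linarith

end Deterministic

/-! ### Measurability of the statistic -/

section Measurability

variable {Ω : Type*} [MeasurableSpace Ω] {P : Measure Ω} {d p : ℕ}

/-- Inversion is not continuous at singular matrices, but it is measurable as the adjugate times the
inverse determinant. -/
lemma measurable_weightedNorm_inv : Measurable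
    fun x : (Fin p → Fin p → ℝ) × EuclideanSpace ℝ (Fin p) =>
      weightedNorm (Matrix.of x.1)⁻¹ x.2 := by
  have h (a b : Fin p) : Measurable fun M : Fin p → Fin p → ℝ => (Matrix.of M)⁻¹ a b := by
    have hc : Continuous fun M : Fin p → Fin p → ℝ => Matrix.of M := continuous_id
    simp only [Matrix.inv_def, Ring.inverse_eq_inv', Matrix.smul_apply, smul_eq_mul]
    exact hc.matrix_det.measurable.inv.mul (hc.matrix_adjugate.matrix_elem a b).measurable
  simp only [weightedNorm, dotProduct, Matrix.mulVec]
  refine Measurable.sqrt (Finset.measurable_sum _ fun a _ => Measurable.mul (by fun_prop)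
    (Finset.measurable_sum _ fun b _ => Measurable.mul ((h a b).comp measurable_fst) (by fun_prop)))

lemma aemeasurable_closedEndStatistic {θ : ((Fin d → ℝ) → ℝ) → EuclideanSpace ℝ (Fin p)}
    {X : ℤ → Ω → Fin d → ℝ}
    (hθ : ∀ i j : ℤ, 1 ≤ i → i ≤ j → AEMeasurable (estimator θ X i j) P)
    {Shat : ℕ → Ω → Matrix (Fin p) (Fin p) ℝ}
    (hShat : ∀ m a b, AEMeasurable (fun ω => Shat m ω a b) P) (w : ℝ≥0 → ℝ) (T m : ℕ) :
    AEMeasurable (fun ω => closedEndStatistic θ X Shat w T m ω) P := by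
  simp only [closedEndStatistic_eq_gridMax]
  refine aemeasurable_gridMax _ fun k j hk hkT hj => ?_
  have hm : m ≠ 0 := fun h => by subst h; omega
  have hS : AEMeasurable (fun ω a b => Shat m ω a b) P :=
    aemeasurable_pi_lambda _ fun a => aemeasurable_pi_lambda _ fun b => hShat m a b
  have h₁ := hθ 1 (m + j) le_rfl (by omega)
  have h₂ := hθ (m + j + 1) (m + k) (by omega) (by omega)
  have hv : AEMeasurable (fun ω => (√(m : ℝ))⁻¹ • (((k : ℝ) - j) •
      (estimator θ X 1 (m + j) ω - estimator θ X (m + j + 1) (m + k) ω))) P := by fun_prop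
  exact (measurable_weightedNorm_inv.comp_aemeasurable (hS.prodMk hv)).congr
    (ae_of_all _ fun ω => rfl)

lemma aemeasurable_remainder {θ : ((Fin d → ℝ) → ℝ) → EuclideanSpace ℝ (Fin p)}
    {X : ℤ → Ω → Fin d → ℝ}
    (hθ : ∀ i j : ℤ, 1 ≤ i → i ≤ j → AEMeasurable (estimator θ X i j) P)
    {F : (Fin d → ℝ) → ℝ} (hI : ∀ t, AEMeasurable (fun ω => influence θ F (X t ω)) P)
    {i j : ℤ} (hi : 1 ≤ i) (hij : i ≤ j) : AEMeasurable (remainder θ F X i j) P := by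
  have h₁ := hθ i j hi hij
  have h₂ : AEMeasurable (fun ω => ∑ t ∈ Finset.Icc i j, influence θ F (X t ω)) P :=
    Finset.aemeasurable_fun_sum _ fun t _ => hI t
  unfold remainder
  fun_prop

end Measurability

/-! ### The difference to the Brownian approximation is negligible -/

lemma remainder_le_iSup {Ω : Type*} {d p : ℕ}
    (θ : ((Fin d → ℝ) → ℝ) → EuclideanSpace ℝ (Fin p))
    (F : (Fin d → ℝ) → ℝ) (X : ℤ → Ω → Fin d → ℝ) (n : ℕ) (ω : Ω) {i j : ℤ} (hi : 1 ≤ i)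
    (hij : i ≤ j) (hj : j ≤ n) :
    ((j - i + 1 : ℤ) : ℝ) / √(n : ℝ) * ‖remainder θ F X i j ω‖ ≤
      ⨆ (j : Finset.Icc (1 : ℤ) n) (i : Finset.Icc (1 : ℤ) (j : ℤ)),
        ((j - i + 1 : ℤ) : ℝ) / √(n : ℝ) * ‖remainder θ F X i j ω‖ :=
  le_ciSup_of_le (Set.finite_range _).bddAbove
    (⟨j, Finset.mem_Icc.2 ⟨hi.trans hij, hj⟩⟩ : Finset.Icc (1 : ℤ) n)
    (le_ciSup_of_le (Set.finite_range _).bddAbove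
      (⟨i, Finset.mem_Icc.2 ⟨hi, hij⟩⟩ : Finset.Icc (1 : ℤ) j) le_rfl)

section Approximation

variable {Ω : Type*} [MeasurableSpace Ω] {P : Measure Ω} {d p : ℕ}

lemma tendsto_measure_remainder [IsProbabilityMeasure P]
    {θ : ((Fin d → ℝ) → ℝ) → EuclideanSpace ℝ (Fin p)} {X : ℤ → Ω → Fin d → ℝ}
    (hθ : ∀ i j : ℤ, 1 ≤ i → i ≤ j → AEMeasurable (estimator θ X i j) P)
    (hI : ∀ t, AEMeasurable (fun ω => influence θ (distFun P (X 0)) (X t ω)) P)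
    (hlin : LinearizationAssumption P θ X) {r : ℝ} (hr : 0 < r) :
    Tendsto (fun n : ℕ => P {ω | ∃ i j : ℤ, 1 ≤ i ∧ i ≤ j ∧ j ≤ n ∧
      r * √(n : ℝ) < ((j - i + 1 : ℤ) : ℝ) * ‖remainder θ (distFun P (X 0)) X i j ω‖}) atTop
      (𝓝 0) := by
  have hm (n : ℕ) : AEStronglyMeasurable (fun ω =>
      ⨆ (j : Finset.Icc (1 : ℤ) n) (i : Finset.Icc (1 : ℤ) (j : ℤ)), ((j - i + 1 : ℤ) : ℝ) /
        √(n : ℝ) * ‖remainder θ (distFun P (X 0)) X i j ω‖) P := by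
    refine AEMeasurable.aestronglyMeasurable (AEMeasurable.iSup fun j => AEMeasurable.iSup fun i =>
      AEMeasurable.const_mul (AEMeasurable.norm ?_) _)
    have hi := Finset.mem_Icc.1 i.2
    exact aemeasurable_remainder hθ hI hi.1 hi.2
  have h := tendstoInMeasure_of_tendsto_ae hm hlin
  rw [tendstoInMeasure_iff_norm] at h
  refine tendsto_of_tendsto_of_tendsto_of_le_of_le tendsto_const_nhds (h r hr)
    (fun _ => zero_le) fun n => measure_mono fun ω hω => ?_
  obtain ⟨i, j, hi, hij, hj, hlt⟩ := hω
  have hn : (0 : ℝ) < n := by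
    have : (0 : ℤ) < n := by omega
    exact_mod_cast this
  refine (le_trans ?_ (remainder_le_iSup θ (distFun P (X 0)) X n ω hi hij hj)).trans
    ((le_abs_self _).trans_eq ?_)
  · rw [div_mul_eq_mul_div, le_div_iff₀ (Real.sqrt_pos.2 hn)]
    exact hlt.le
  · rw [sub_zero, Real.norm_eq_abs]

lemma tendsto_measure_exists_le_abs_sub {S : Matrix (Fin p) (Fin p) ℝ}
    {Shat : ℕ → Ω → Matrix (Fin p) (Fin p) ℝ}
    (h : ∀ a b, TendstoInMeasure P (fun m ω => Shat m ω a b) atTop (fun _ => S a b)) {η : ℝ}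
    (hη : 0 < η) :
    Tendsto (fun m => P {ω | ∃ a b, η ≤ |Shat m ω a b - S a b|}) atTop (𝓝 0) := by
  have hsum : Tendsto (fun m => ∑ a, ∑ b, P {ω | η ≤ |Shat m ω a b - S a b|}) atTop (𝓝 0) := by
    have h0 : (0 : ℝ≥0∞) = ∑ _a : Fin p, ∑ _b : Fin p, 0 := by simp
    rw [h0]
    exact tendsto_finsetSum _ fun a _ => tendsto_finsetSum _ fun b _ =>
      (tendstoInMeasure_iff_norm.1 (h a b)) η hη
  refine tendsto_of_tendsto_of_tendsto_of_le_of_le tendsto_const_nhds hsum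
    (fun _ => zero_le) fun m => ?_
  have hset : {ω | ∃ a b, η ≤ |Shat m ω a b - S a b|} =
      ⋃ a, ⋃ b, {ω | η ≤ |Shat m ω a b - S a b|} := by
    ext ω
    simp
  rw [hset]
  exact (measure_iUnion_fintype_le _ _).trans
    (Finset.sum_le_sum fun a _ => measure_iUnion_fintype_le _ _)

/-- The pathwise comparison of the statistic with its Brownian approximation. -/
lemma abs_closedEndStatistic_sub_le {θ : ((Fin d → ℝ) → ℝ) → EuclideanSpace ℝ (Fin p)}
    {X : ℤ → Ω → Fin d → ℝ} (hstat : StrictlyStationary P X)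
    {Shat : ℕ → Ω → Matrix (Fin p) (Fin p) ℝ} {S : Matrix (Fin p) (Fin p) ℝ} (hS : 0 ≤ S)
    (hdet : S.det ≠ 0) {w : ℝ≥0 → ℝ} (hw : IsCutoffWeight w)
    {W₁ W₂ : ℝ≥0 → Ω → EuclideanSpace ℝ (Fin p)} {T m : ℕ} (hm : 0 < m) {ω : Ω}
    {a ρ K r δ ε C : ℝ} (hC0 : 0 ≤ C) (hC : ∀ t ≤ (T : ℝ≥0), w t ≤ C)
    (h₁ : ∀ k ≤ T * m, ‖∑ t ∈ Finset.Icc ((m : ℤ) + 1) (m + k), influenceAt P θ X t ω -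
      sqrtMulVec S (W₁ k ω)‖ ≤ a)
    (h₂ : ‖∑ t ∈ Finset.Icc (1 : ℤ) m, influenceAt P θ X t ω - sqrtMulVec S (W₂ m ω)‖ ≤ a)
    (hR : ∀ i j : ℤ, 1 ≤ i → i ≤ j → j ≤ (T + 1) * m →
      ((j - i + 1 : ℤ) : ℝ) * ‖remainder θ (distFun P (X 0)) X i j ω‖ ≤ ρ)
    (hK : gridFunctional 1 T m (fun k => drivingPath W₁ W₂ m k ω) ≤ K)
    (hδ : (√(m : ℝ))⁻¹ * (2 * (T + 2) * a + (T + 1) * ρ) ≤ δ) (hδ1 : δ ≤ 1)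
    (hM : ‖Matrix.toEuclideanCLM (𝕜 := ℝ) ((Shat m ω)⁻¹ - S⁻¹)‖ ≤ r) (hε : 0 ≤ ε)
    (hr : r * (‖Matrix.toEuclideanCLM (𝕜 := ℝ) (CFC.sqrt S)‖ * K + 1) ^ 2 ≤ ε ^ 2 / 2)
    (hδS : ‖Matrix.toEuclideanCLM (𝕜 := ℝ) S⁻¹‖ * δ *
      (2 * (‖Matrix.toEuclideanCLM (𝕜 := ℝ) (CFC.sqrt S)‖ * K) + 1) ≤ ε ^ 2 / 2) :
    |closedEndStatistic θ X Shat w T m ω -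
      gridFunctional w T m (fun k => drivingPath W₁ W₂ m k ω)| ≤ C * ε := by
  rw [closedEndStatistic_eq_gridMax, gridFunctional]
  refine abs_gridMax_sub_le (fun _ => hw.nonneg _) (fun _ _ => Real.sqrt_nonneg _)
    (fun k j => by positivity) hC0 (fun k hk => hC _ ?_) hε fun k j hk hkT hj => ?_
  · rw [div_le_iff₀ (Nat.cast_pos.2 hm)]
    exact_mod_cast hk
  have hest (i j : ℤ) : estimator θ X i j ω = θ (distFun P (X 0)) +
      ((j - i + 1 : ℤ) : ℝ)⁻¹ • ∑ t ∈ Finset.Icc i j, influenceAt P θ X t ω +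
        remainder θ (distFun P (X 0)) X i j ω := by
    simp only [remainder, influenceAt_eq hstat]
    abel
  have hb := norm_smul_estimator_sub_le hest hm h₂ h₁ hR hj hkT
  set y : EuclideanSpace ℝ (Fin p) := ((k : ℝ) / m + 1) •
    (drivingPath W₁ W₂ m k ω - drivingPath W₁ W₂ m j ω) with hy
  have hyn : ((k : ℝ) / m + 1) * ‖drivingPath W₁ W₂ m k ω - drivingPath W₁ W₂ m j ω‖ =
      ‖y‖ := by
    rw [hy, norm_smul, Real.norm_of_nonneg (by positivity)]
  rw [hyn]
  have hyK : ‖y‖ ≤ K := by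
    refine le_trans (le_of_eq ?_) ((le_gridMax (w := fun _ => 1) (fun _ => zero_le_one)
      hk hkT hj).trans hK)
    rw [← hyn, one_mul]
  refine abs_weightedNorm_sub_norm_le hS hdet hδ1 ?_ (le_trans ?_ hδ) hM hε hr hδS
  · exact (ContinuousLinearMap.le_opNorm _ _).trans (mul_le_mul_of_nonneg_left hyK (norm_nonneg _))
  · rw [hy, smul_drivingPath_sub _ _ hm]
    simp only [sqrtMulVec, map_smul, map_sub, map_add] at hb ⊢
    rw [← smul_sub, norm_smul, Real.norm_of_nonneg (by positivity)]
    exact mul_le_mul_of_nonneg_left hb (by positivity)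

end Approximation

/-! ### The limits for the weight functions `weightGamma` -/

lemma continuous_weightGamma {γ ε : ℝ} (hγ : 0 ≤ γ) (hε : 0 < ε) :
    Continuous (weightGamma γ ε) := by
  have h1 (t : ℝ≥0) : 1 + (t : ℝ) ≠ 0 := by positivity
  have h2 (t : ℝ≥0) : max (((t : ℝ) / (1 + t)) ^ γ) ε ≠ 0 := (lt_max_of_lt_right hε).ne'
  unfold weightGamma
  refine Continuous.mul (Continuous.inv₀ (by fun_prop) h1) (Continuous.inv₀ ?_ h2)
  refine Continuous.max (Continuous.rpow_const ?_ fun _ => Or.inr hγ) continuous_const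
  exact Continuous.div (by fun_prop) (by fun_prop) h1

lemma weightGamma_pos {γ ε : ℝ} (hε : 0 < ε) (t : ℝ≥0) : 0 < weightGamma γ ε t := by
  have : 0 < max (((t : ℝ) / (1 + t)) ^ γ) ε := lt_max_of_lt_right hε
  unfold weightGamma
  positivity

/-- The map `t ↦ t/(t+1)` is an increasing bijection of `[0, T]` onto `[0, T/(T+1)]` with inverse `u
↦ u/(1-u)`, and `(t + 1) w_γ(t) = 1 / max(u^γ, ε)`. -/
lemma closedEndLimit_weightGamma {Ω' : Type*} {p : ℕ}
    {W : ℝ≥0 → Ω' → EuclideanSpace ℝ (Fin p)} {γ ε : ℝ} (hγ : 0 ≤ γ)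
    (hε : 0 < ε) (T : ℕ) {ω : Ω'} (hc : Continuous fun t => W t ω) :
    closedEndLimit W (weightGamma γ ε) T ω = limitGamma W γ ε T ω := by
  have hw := isCutoffWeight_of_continuous (continuous_weightGamma hγ hε)
    (weightGamma_pos (γ := γ) hε)
  have hval (t s : ℝ≥0) : ((t : ℝ) + 1) * weightGamma γ ε t *
      ‖W (t / (t + 1)) ω - W (s / (s + 1)) ω‖ =
      1 / max (((t / (t + 1) : ℝ≥0) : ℝ) ^ γ) ε * ‖W (t / (t + 1)) ω - W (s / (s + 1)) ω‖ := by
    have : (t : ℝ) + 1 ≠ 0 := by positivity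
    congr 1
    rw [weightGamma, add_comm (1 : ℝ), mul_inv_cancel_left₀ this, one_div]
    push_cast
    rfl
  have hmono {s t : ℝ≥0} (hst : s ≤ t) : s / (s + 1) ≤ t / (t + 1) := by
    rw [div_le_div_iff₀ (by positivity) (by positivity), mul_add, mul_add, mul_comm t s]
    gcongr
  have hsurj {u : ℝ≥0} (hu : u < 1) : u / (1 - u) / (u / (1 - u) + 1) = u := by
    have h1 : 1 - u ≠ 0 := (tsub_pos_of_lt hu).ne'
    have h2 : u / (1 - u) + 1 = 1 / (1 - u) := by
      rw [eq_div_iff h1, add_mul, div_mul_cancel₀ _ h1, one_mul, add_tsub_cancel_of_le hu.le]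
    rw [h2, div_div_div_cancel_right₀ h1, div_one]
  have hT1 : (T : ℝ≥0) / (T + 1) < 1 := by
    rw [div_lt_one (by positivity)]
    exact lt_add_one _
  have hinv {u : ℝ≥0} (hu : u ≤ (T : ℝ≥0) / (T + 1)) : u / (1 - u) ≤ T := by
    have h1 : 0 < 1 - u := tsub_pos_of_lt (hu.trans_lt hT1)
    rw [le_div_iff₀ (by positivity), mul_add, mul_one] at hu
    rw [div_le_iff₀ h1, mul_tsub, mul_one, mul_comm]
    exact le_tsub_of_add_le_left hu
  have hle (u v : ℝ≥0) (hu : u ≤ (T : ℝ≥0) / (T + 1)) (hv : v ≤ u) :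
      1 / max ((u : ℝ) ^ γ) ε * ‖W u ω - W v ω‖ ≤ closedEndLimit W (weightGamma γ ε) T ω := by
    have hu1 := hu.trans_lt hT1
    have h := le_closedEndLimit hw hc (s := v / (1 - v)) (t := u / (1 - u))
      (div_le_div₀ zero_le hv (tsub_pos_of_lt hu1) (tsub_le_tsub_left hv 1)) (hinv hu)
    rwa [hval, hsurj hu1, hsurj (hv.trans_lt hu1)] at h
  have h0 := closedEndLimit_nonneg (W := W) (T := T) (ω := ω) hw
  have hbs (u : Set.Ioc (0 : ℝ≥0) ((T : ℝ≥0) / (T + 1))) : BddAbove (Set.range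
      fun v : Set.Icc (0 : ℝ≥0) (u : ℝ≥0) =>
        1 / max (((u : ℝ≥0) : ℝ) ^ γ) ε * ‖W u ω - W v ω‖) :=
    ⟨_, Set.forall_mem_range.2 fun v => hle u v u.2.2 v.2.2⟩
  have hnn (u v : ℝ≥0) : 0 ≤ 1 / max ((u : ℝ) ^ γ) ε * ‖W u ω - W v ω‖ :=
    mul_nonneg (one_div_nonneg.2 (hε.le.trans (le_max_right _ _))) (norm_nonneg _)
  refine le_antisymm (closedEndLimit_le ?_ fun t s hst ht => ?_) ?_
  · exact Real.iSup_nonneg fun u => Real.iSup_nonneg fun v => hnn u v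
  · rw [hval]
    -- The time `0` is excluded on the right, but it forces `s = 0` and contributes nothing.
    rcases eq_or_ne t 0 with rfl | ht0
    · rw [nonpos_iff_eq_zero.1 hst, sub_self, norm_zero, mul_zero]
      exact Real.iSup_nonneg fun u => Real.iSup_nonneg fun v => hnn u v
    · exact le_ciSup_of_le ⟨_, Set.forall_mem_range.2 fun u =>
        Real.iSup_le (fun v => hle u v u.2.2 v.2.2) h0⟩
        (⟨t / (t + 1), by positivity, hmono ht⟩ : Set.Ioc (0 : ℝ≥0) ((T : ℝ≥0) / (T + 1)))
        (le_ciSup_of_le (hbs _) ⟨s / (s + 1), zero_le, hmono hst⟩ le_rfl)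
  · exact Real.iSup_le (fun u => Real.iSup_le (fun v => hle u v u.2.2 v.2.2) h0) h0

/-! ### The main results -/

section Main

variable {Ω Ω' : Type*} [MeasurableSpace Ω] [MeasurableSpace Ω']
  {P : Measure Ω} [IsProbabilityMeasure P] {P' : Measure Ω'} [IsProbabilityMeasure P']
  {d p : ℕ}

lemma tendsto_inv_sqrt_mul_rpow {ξ : ℝ} (hξ : ξ < 1 / 2) (c : ℝ) (T : ℕ) :
    Tendsto (fun m : ℕ => (√(m : ℝ))⁻¹ * (c * (((T + 1) * m : ℕ) : ℝ) ^ ξ)) atTop (𝓝 0) := by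
  have h : Tendsto (fun m : ℕ => (m : ℝ) ^ (-(1 / 2 - ξ))) atTop (𝓝 0) :=
    (tendsto_rpow_neg_atTop (by linarith)).comp tendsto_natCast_atTop_atTop
  have h' := h.const_mul (c * ((T : ℝ) + 1) ^ ξ)
  rw [mul_zero] at h'
  refine h'.congr' ?_
  filter_upwards [eventually_gt_atTop 0] with m hm
  have hm' : (0 : ℝ) < m := Nat.cast_pos.2 hm
  push_cast
  rw [Real.mul_rpow (by positivity) hm'.le, Real.sqrt_eq_rpow, ← Real.rpow_neg hm'.le,
    show -(1 / 2 - ξ) = -(1 / 2) + ξ by ring, Real.rpow_add hm']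
  ring

/-- The approximation bound starts at `k = 1`, while the detector also uses `j = 0`. There `hfg` is
used; it holds almost surely in the application because the sum is empty and `W₁(0) = 0`. -/
lemma norm_sub_le_of_iSup_le {E : Type*} [NormedAddCommGroup E] {ξ : ℝ} (hξ : 0 ≤ ξ)
    {f g : ℕ → E} {A : ℝ≥0}
    (h : ⨆ (k : ℕ) (_ : 1 ≤ k), ENNReal.ofReal (((k : ℝ) ^ ξ)⁻¹ * ‖f k - g k‖) ≤ A)
    (hfg : f 0 = g 0) {k N : ℕ} (hk : k ≤ N) : ‖f k - g k‖ ≤ A * (N : ℝ) ^ ξ := by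
  rcases Nat.eq_zero_or_pos k with rfl | hk0
  · rw [hfg, sub_self, norm_zero]
    positivity
  have h1 := (le_iSup₂ (f := fun (k : ℕ) (_ : 1 ≤ k) =>
    ENNReal.ofReal (((k : ℝ) ^ ξ)⁻¹ * ‖f k - g k‖)) k hk0).trans h
  have hk' : (0 : ℝ) < k := Nat.cast_pos.2 hk0
  rw [ENNReal.ofReal_le_coe, inv_mul_le_iff₀ (Real.rpow_pos_of_pos hk' _)] at h1
  refine h1.trans ?_
  rw [mul_comm]
  gcongr

theorem tendstoInDistribution_closedEndStatistic
    {θ : ((Fin d → ℝ) → ℝ) → EuclideanSpace ℝ (Fin p)} {X : ℤ → Ω → Fin d → ℝ}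
    (hθ : ∀ i j : ℤ, 1 ≤ i → i ≤ j → AEMeasurable (estimator θ X i j) P)
    {S : Matrix (Fin p) (Fin p) ℝ} (happrox : ApproximationAssumption P θ X S)
    (hlin : LinearizationAssumption P θ X) {Shat : ℕ → Ω → Matrix (Fin p) (Fin p) ℝ}
    (hShat_meas : ∀ m a b, AEMeasurable (fun ω => Shat m ω a b) P)
    (hShat_consistent : ∀ a b,
      TendstoInMeasure P (fun m ω => Shat m ω a b) atTop (fun _ => S a b))
    {W : ℝ≥0 → Ω' → EuclideanSpace ℝ (Fin p)} (hW : IsStdBrownian W P') (T : ℕ)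
    {w : ℝ≥0 → ℝ} (hw : IsCutoffWeight w) :
    TendstoInDistribution (fun m ω => closedEndStatistic θ X Shat w T m ω) atTop
      (closedEndLimit W w T) (fun _ => P) P' := by
  obtain ⟨ξ, W₁, W₂, hξ0, hξ, hB, hb₁, hb₂⟩ := happrox.approx
  have hstat := happrox.stationary
  have hdet := happrox.nonsingular
  have hS : 0 ≤ S := IsLongRunVariance.nonneg hstat happrox.influence_memLp (by
    have h := happrox.longRunVariance
    simpa only [IsLongRunVariance, influenceAt_eq hstat] using h)
  have hI (t : ℤ) : AEMeasurable (fun ω => influence θ (distFun P (X 0)) (X t ω)) P :=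
    (memLp_comp_of_stationary hstat happrox.influence_memLp t).1.aemeasurable
  have hmain := tendstoInDistribution_gridFunctional (fun m => (hB m).1) (fun m => (hB m).2.1) hW
    (fun m => (hB m).2.2) hw T
  refine tendstoInDistribution_of_tendstoInMeasure_sub _ _ hmain ?_
    fun m => aemeasurable_closedEndStatistic hθ hShat_meas w T m
  rw [tendstoInMeasure_iff_norm]
  intro ε' hε'
  rw [ENNReal.tendsto_nhds_zero]
  intro η hη
  have hη5 : 0 < η / 5 := ENNReal.div_pos hη.ne' (by simp)
  obtain ⟨C, hC0, hC⟩ := hw.exists_le T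
  -- With weight `1`, `K` bounds all scaled increments of the driving path, also where `w` vanishes.
  obtain ⟨K, hK0, hK⟩ := exists_forall_measure_gridFunctional_gt_le (fun m => (hB m).1)
    (fun m => (hB m).2.1) hW (fun m => (hB m).2.2)
    (isCutoffWeight_of_continuous (w := 1) continuous_const fun _ => one_pos) T hη5
  obtain ⟨A₁, hA₁⟩ := hb₁ _ hη5
  obtain ⟨A₂, hA₂⟩ := hb₂ _ hη5
  set A : ℝ≥0 := max A₁ A₂ with hA
  -- The `+ 1` makes `C * ε < ε'` strict and covers `C = 0`.
  set ε : ℝ := ε' / (C + 1) with hε_def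
  have hε : 0 < ε := by positivity
  have hCε : C * ε < ε' := by
    rw [hε_def, mul_div_assoc', div_lt_iff₀ (by positivity)]
    nlinarith
  set K' : ℝ := ‖Matrix.toEuclideanCLM (n := Fin p) (𝕜 := ℝ) (CFC.sqrt S)‖ * K with hK'
  have hK'0 : 0 ≤ K' := by positivity
  set s : ℝ := ‖Matrix.toEuclideanCLM (n := Fin p) (𝕜 := ℝ) S⁻¹‖ with hs
  have hs0 : 0 ≤ s := norm_nonneg _
  set r : ℝ := ε ^ 2 / 2 / (K' + 1) ^ 2 with hr_def
  have hr0 : 0 < r := by positivity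
  have hr : r * (K' + 1) ^ 2 ≤ ε ^ 2 / 2 := by
    rw [hr_def, div_mul_cancel₀ _ (by positivity)]
  -- The factor `s + 1` keeps the denominator positive when `s = 0`.
  set δ : ℝ := min 1 (ε ^ 2 / 2 / ((s + 1) * (2 * K' + 1))) with hδ_def
  have hδ0 : 0 < δ := lt_min one_pos (by positivity)
  have hδS : s * δ * (2 * K' + 1) ≤ ε ^ 2 / 2 := by
    have h1 : δ * ((s + 1) * (2 * K' + 1)) ≤ ε ^ 2 / 2 :=
      (le_div_iff₀ (by positivity)).1 (min_le_right _ _)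
    have h2 : 0 ≤ δ * (2 * K' + 1) := by positivity
    nlinarith
  -- The last observation has index at most `(T + 1) m`, so the linearization is used at that
  -- length. As `√((T + 1) m) = √(T + 1) √m`, the remainders take exactly `δ / 2`; the other half is
  -- for the strong approximation.
  set r' : ℝ := δ / 2 / ((T + 1) * √((T : ℝ) + 1)) with hr'_def
  have hr'0 : 0 < r' := by positivity
  obtain ⟨κ, hκ0, hκ⟩ := exists_forall_abs_sub_lt_norm_inv_sub_lt hdet hr0
  have hN : Tendsto (fun m : ℕ => (T + 1) * m) atTop atTop :=
    tendsto_id.const_mul_atTop' (Nat.succ_pos T)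
  have h3 := ((tendsto_measure_remainder hθ hI hlin hr'0).comp hN).eventually_le_const hη5
  have h4 := (tendsto_measure_exists_le_abs_sub hShat_consistent hκ0).eventually_le_const hη5
  have h5 := (tendsto_inv_sqrt_mul_rpow hξ (2 * (T + 2) * A) T).eventually_le_const (half_pos hδ0)
  filter_upwards [hA₁, hA₂, h3, h4, h5, eventually_gt_atTop 0] with m h1 h2 h3 h4 h5 hm
  have h0 : P {ω | ¬ W₁ m 0 ω = 0} = 0 := by
    have hae : ∀ᵐ ω ∂P, W₁ m 0 ω = 0 := by
      filter_upwards [ae_all_iff.2 fun a => ((hB m).1.brownian a).eval_zero_ae_eq_zero] with ω hω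
      ext a
      exact hω a
    exact ae_iff.1 hae
  have h5' := hK m
  simp only [Function.comp_apply] at h3
  have hm' : (0 : ℝ) < m := Nat.cast_pos.2 hm
  -- A large difference forces one of five events of probability at most `η / 5`, or the null event
  -- `W₁(0) ≠ 0`.
  have hsub : {ω | ε' ≤ ‖((fun m ω => closedEndStatistic θ X Shat w T m ω) -
      fun m ω => gridFunctional w T m (fun k => drivingPath (W₁ m) (W₂ m) m k ω)) m ω -
        (0 : ℕ → Ω → ℝ) m ω‖} ⊆ {ω | ¬ W₁ m 0 ω = 0} ∪ (({ω | (A₁ : ℝ≥0∞) < ⨆ (k : ℕ) (_ : 1 ≤ k),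
        ENNReal.ofReal (((k : ℝ) ^ ξ)⁻¹ * ‖∑ t ∈ Finset.Icc ((m : ℤ) + 1) (m + k),
          influenceAt P θ X t ω - sqrtMulVec S (W₁ m k ω)‖)} ∪
      {ω | (A₂ : ℝ≥0∞) < ENNReal.ofReal (((m : ℝ) ^ ξ)⁻¹ * ‖∑ t ∈ Finset.Icc (1 : ℤ) m,
        influenceAt P θ X t ω - sqrtMulVec S (W₂ m m ω)‖)}) ∪ (({ω | ∃ i j : ℤ, 1 ≤ i ∧ i ≤ j ∧
      j ≤ (((T + 1) * m : ℕ) : ℤ) ∧ r' * √(((T + 1) * m : ℕ) : ℝ) < ((j - i + 1 : ℤ) : ℝ) *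
        ‖remainder θ (distFun P (X 0)) X i j ω‖} ∪
      {ω | ∃ a b, κ ≤ |Shat m ω a b - S a b|}) ∪
      {ω | K < gridFunctional 1 T m (fun k => drivingPath (W₁ m) (W₂ m) m k ω)})) := by
    intro ω hω
    by_contra hnot
    simp only [Set.mem_union, Set.mem_ofPred_eq, not_or, not_not, not_exists, not_and, not_lt,
      not_le] at hnot
    obtain ⟨g0, ⟨g1, g2⟩, ⟨g3, g4⟩, g5⟩ := hnot
    have hmN : m ≤ (T + 1) * m := Nat.le_mul_of_pos_left m (Nat.succ_pos T)
    have b₁ (k : ℕ) (hk : k ≤ T * m) : ‖∑ t ∈ Finset.Icc ((m : ℤ) + 1) (m + k),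
        influenceAt P θ X t ω - sqrtMulVec S (W₁ m k ω)‖ ≤ A * (((T + 1) * m : ℕ) : ℝ) ^ ξ := by
      refine norm_sub_le_of_iSup_le hξ0.le (f := fun k : ℕ =>
        ∑ t ∈ Finset.Icc ((m : ℤ) + 1) (m + k),
        influenceAt P θ X t ω) (g := fun k : ℕ => sqrtMulVec S (W₁ m k ω))
        (g1.trans (ENNReal.coe_le_coe.2 (le_max_left _ _))) ?_ (hk.trans ?_)
      · simp [g0, sqrtMulVec]
      · exact Nat.mul_le_mul_right m (Nat.le_succ T)
    have b₂ : ‖∑ t ∈ Finset.Icc (1 : ℤ) m, influenceAt P θ X t ω - sqrtMulVec S (W₂ m m ω)‖ ≤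
        A * (((T + 1) * m : ℕ) : ℝ) ^ ξ := by
      have h := g2.trans (ENNReal.coe_le_coe.2 (le_max_right A₁ A₂))
      rw [ENNReal.ofReal_le_coe, inv_mul_le_iff₀ (Real.rpow_pos_of_pos hm' _), mul_comm] at h
      refine h.trans ?_
      gcongr
    have bδ : (√(m : ℝ))⁻¹ * (2 * (T + 2) * (A * (((T + 1) * m : ℕ) : ℝ) ^ ξ) +
        (T + 1) * (r' * √(((T + 1) * m : ℕ) : ℝ))) ≤ δ := by
      have e1 : (√(m : ℝ))⁻¹ * ((T + 1) * (r' * √(((T + 1) * m : ℕ) : ℝ))) = δ / 2 := by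
        have hsm : √(m : ℝ) ≠ 0 := by positivity
        have hsT : √((T : ℝ) + 1) ≠ 0 := by positivity
        push_cast
        rw [Real.sqrt_mul (by positivity), hr'_def]
        field_simp
      rw [mul_add, e1]
      have e2 : (√(m : ℝ))⁻¹ * (2 * (T + 2) * (A * (((T + 1) * m : ℕ) : ℝ) ^ ξ)) ≤ δ / 2 := by
        refine le_trans (le_of_eq ?_) h5
        ring
      linarith
    have hfin := abs_closedEndStatistic_sub_le hstat hS hdet hw hm hC0 hC b₁ b₂
      (fun i j hi hij hj => g3 i j hi hij (by push_cast; exact hj)) g5 bδ (min_le_left _ _)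
      (hκ _ g4).le hε.le hr hδS
    rw [Set.mem_ofPred_eq, Pi.zero_apply, Pi.zero_apply, sub_zero, Pi.sub_apply, Pi.sub_apply,
      Real.norm_eq_abs] at hω
    exact absurd (hω.trans hfin) (not_le.2 hCε)
  refine (measure_mono hsub).trans ?_
  calc _ ≤ 0 + ((η / 5 + η / 5) + ((η / 5 + η / 5) + η / 5)) :=
        (measure_union_le _ _).trans (add_le_add h0.le ((measure_union_le _ _).trans (add_le_add
          ((measure_union_le _ _).trans (add_le_add h1 h2)) ((measure_union_le _ _).trans
            (add_le_add ((measure_union_le _ _).trans (add_le_add h3 h4)) h5')))))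
    _ = 5 * (η / 5) := by ring
    _ = η := ENNReal.mul_div_cancel (by simp) (by simp)

end Main

end Monitoring

theorem mainTheorem6 {Ω Ω' : Type*} [MeasurableSpace Ω] [MeasurableSpace Ω']
    (P : Measure Ω) [IsProbabilityMeasure P] (P' : Measure Ω') [IsProbabilityMeasure P']
    {d p : ℕ} (T : ℕ) (hT : 1 ≤ T)
    (θ : ((Fin d → ℝ) → ℝ) → EuclideanSpace ℝ (Fin p))
    (X : ℤ → Ω → Fin d → ℝ) (hX : ∀ t, Measurable (X t))
    (hθ : ∀ i j : ℤ, 1 ≤ i → i ≤ j → AEMeasurable (estimator θ X i j) P)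
    (S : Matrix (Fin p) (Fin p) ℝ)
    (hnull : NullHypothesis P θ X T)
    (happrox : ApproximationAssumption P θ X S)
    (hlin : LinearizationAssumption P θ X)
    (Shat : ℕ → Ω → Matrix (Fin p) (Fin p) ℝ)
    (hShat_meas : ∀ m a b, AEMeasurable (fun ω => Shat m ω a b) P)
    (hShat_nonsing : ∀ m, ∀ᵐ ω ∂P, (Shat m ω).det ≠ 0)
    (hShat_consistent : ∀ a b,
      TendstoInMeasure P (fun m ω => Shat m ω a b) atTop (fun _ => S a b))
    (W : ℝ≥0 → Ω' → EuclideanSpace ℝ (Fin p)) (hW : IsStdBrownian W P') :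
    (∀ w : ℝ≥0 → ℝ, IsWeightFunction w →
      TendstoInDistribution (fun m ω => closedEndStatistic θ X Shat w T m ω) atTop
        (closedEndLimit W w T) (fun _ => P) P') ∧
    (∀ γ ε : ℝ, 0 ≤ γ → γ < 1 / 2 → 0 < ε →
      TendstoInDistribution
        (fun m ω => closedEndStatistic θ X Shat (weightGamma γ ε) T m ω) atTop
        (closedEndLimit W (weightGamma γ ε) T) (fun _ => P) P' ∧
      IdentDistrib (closedEndLimit W (weightGamma γ ε) T) (limitGamma W γ ε T) P' P') := by
  refine ⟨fun w hw => tendstoInDistribution_closedEndStatistic hθ happrox hlin hShat_meas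
    hShat_consistent hW T hw.isCutoffWeight, fun γ ε hγ _ hε => ?_⟩
  -- On the bounded horizon `[0, T]`, continuity and positivity of the weight suffice.
  have hw := isCutoffWeight_of_continuous (continuous_weightGamma hγ hε)
    (weightGamma_pos (γ := γ) hε)
  exact ⟨tendstoInDistribution_closedEndStatistic hθ happrox hlin hShat_meas hShat_consistent hW T
    hw, IdentDistrib.of_ae_eq (aemeasurable_closedEndLimit hW hw T)
    (hW.ae_continuous.mono fun ω hω => closedEndLimit_weightGamma hγ hε T hω)⟩
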